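/- \textbf{Conventions.} Digraphs are finite and may have multiple edges; $u$ reaches $v$ if there is a path from $u$ to $v$; SCC means strongly connected component (given by its vertex set); $G\setminus e$ is $G$ with one copy of the edge $e$ deleted; $e$ is a \emph{strong bridge} of $G$ if deleting it increases the number of SCCs; $G^R$ is $G$ with all edges reversed. Let $G$ be strongly connected with a start vertex $s$ (written $G_s$). A vertex $u$ \emph{dominates} $v$ if every path from $s$ to $v$ contains $u$; $d(v)$ is the immediate dominator of $v\ne s$; $D(r)$ is the set of vertices dominated by $r$. An edge $(x,y)$ is a \emph{bridge} of $G_s$ if $s$ does not reach $y$ in $G\setminus(x,y)$, and then $y$ is \emph{marked}. For $r$ equal to $s$ or marked, $T(r)$ is the set of $v\in D(r)$ such that no marked $z\in D(r)$, $z\neq r$, dominates $v$. \textbf{Auxiliary graphs.} $H(G_s,r)$ is obtained from $G$ by shrinking $D(z)$ into $z$ for every marked $z$ with $d(z)\in T(r)$ and, if $r\ne s$, shrinking $V(G)\setminus D(r)$ into $d(r)$; self-loops are dropped and multiple edges become double edges. Its ordinary vertices are those of $T(r)$, all others are auxiliary. Write $H_r=H(G_s,r)$, regarded as having start vertex $r$.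 For $r'$ equal to $r$ or a marked vertex of $H_r^R$ (with start vertex $r$), write $H_{rr'}=H(H_r^R,r')$. A vertex of $H_{rr'}$ is \emph{ordinary} if it is ordinary both in $H_r$ and in $H(H_r^R,r')$; otherwise it is \emph{auxiliary}. If $r'\neq r$, $d(r')$ denotes the immediate dominator of $r'$ in $H_r^R$. For a strong bridge $(a,b)$ of a strongly connected digraph $K$ and an SCC $C$ of $K\setminus(a,b)$, let $C'$ be the digraph on $C\cup\{a,b\}$ whose edges are: the edges of $K$ inside $C$; an edge $(u,a)$ for every edge of $K$ that leaves $C$ at $u\in C$; an edge $(b,v)$ for every edge of $K$ that enters $C$ at $v\in C$; and the edge $(a,b)$. $S(K,(a,b))$ is the set of all these digraphs $C'$. For $K=H_{rr'}$ and $(a,b)=(d(r'),r')$, a vertex of $C'$ is \emph{ordinary} if it lies in $C$ and is ordinary in $H_{rr'}$; otherwise it is \emph{auxiliary}. For a marked vertex $r$ of $G_s$, with $d(r)$ its immediate dominator in $G_s$, let $(\ast)_w$ be the condition that all edges of $H_{rr}$ leaving $d(r)$ go to the single vertex $w$, where $w$ is auxiliary in $H_r$ but ordinary in $H(H_r^R,r)$.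 Let $\widetilde H_{rr}$ be $H_{rr}$ with $d(r)$ removed and an edge $(r,w)$ added if $(\ast)_w$ holds for some (necessarily unique) $w$, and $\widetilde H_{rr}=H_{rr}$ otherwise. \textbf{Proposition.} Let $G_s$ be a strongly connected digraph with start vertex $s$. Let $H$ be one of the following digraphs: (1) $H_{ss}$; (2) $\widetilde H_{rr}$, where $r$ is a marked vertex of $G_s$; (3) a graph in $S(H_{sr'},(d(r'),r'))$, where $r'$ is a marked vertex of $H_s^R$; (4) a graph in $S(H_{rr'},(d(r'),r'))$, where $r$ is a marked vertex of $G_s$ and $r'$ is a marked vertex of $H_r^R$. Let $e=(x,y)$ be a strong bridge of $H$. Then the SCCs of $H\setminus e$ are given by one of the following: (i) $\{x\}$ and $V(H)\setminus\{x\}$, where $x$ is auxiliary; (ii) $\{y\}$ and $V(H)\setminus\{y\}$, where $y$ is auxiliary; (iii) $\{x\}$, $\{y\}$ and $V(H)\setminus\{x,y\}$, where $x$ and $y$ are both auxiliary; (iv) only for $H$ of type (3) or (4), and only if $H$ has exactly the four vertices $x,y,d(r'),r'$ and arises from the component $C=\{x,y\}$: $\{x\}$, $\{y\}$, $\{d(r')\}$,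 $\{r'\}$, where $x$ and $y$ are both auxiliary. Moreover, for the unsimplified graph $H=H_{rr}$ ($r$ a marked vertex of $G_s$) and a strong bridge $e=(x,y)$ of it, one of (i), (ii), (iii) holds, or $(\ast)_x$ holds, $x$ and $d(r)$ are auxiliary, and the SCCs of $H\setminus e$ are either $\{x\}$, $\{d(r)\}$ and $V(H)\setminus\{x,d(r)\}$, or $\{x\}$, $\{y\}$, $\{d(r)\}$ and $V(H)\setminus\{x,y,d(r)\}$ with $y$ auxiliary as well. -/

import Mathlib

/-- A finite directed multigraph on vertices drawn from `V`: a vertex set, and for each ordered pair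
`(u, v)` the number of parallel edges from `u` to `v`. Edges only join vertices of the graph. -/
structure MultiDigraph (V : Type*) where
  verts : Set V
  mult : V → V → ℕ
  mem_verts : ∀ u v, mult u v ≠ 0 → u ∈ verts ∧ v ∈ verts

namespace MultiDigraph

noncomputable section

open scoped Classical

variable {V : Type*}

/-- The multigraph with vertex set `S` and the edges prescribed by `m` inside `S`. -/
def ofMult (S : Set V) (m : V → V → ℕ) : MultiDigraph V where
  verts := S
  mult u v := if u ∈ S ∧ v ∈ S then m u v else 0
  mem_verts u v h := by
    by_contra hc
    exact h (if_neg hc)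

/-- `(u, v)` is an edge. -/
def Adj (G : MultiDigraph V) (u v : V) : Prop := 0 < G.mult u v

/-- `u` reaches `v`. -/
def Reach (G : MultiDigraph V) (u v : V) : Prop := Relation.ReflTransGen G.Adj u v

/-- `u` and `v` are vertices that reach each other. -/
def StronglyConn (G : MultiDigraph V) (u v : V) : Prop :=
  u ∈ G.verts ∧ v ∈ G.verts ∧ G.Reach u v ∧ G.Reach v u

/-- Every two vertices reach each other. -/
def IsStronglyConnected (G : MultiDigraph V) : Prop :=
  ∀ u ∈ G.verts, ∀ v ∈ G.verts, G.StronglyConn u v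

/-- The vertex sets of the strongly connected components. -/
def sccs (G : MultiDigraph V) : Set (Set V) :=
  {C | ∃ v ∈ G.verts, C = {u | G.StronglyConn u v}}

/-- The reverse digraph. -/
def reverse (G : MultiDigraph V) : MultiDigraph V where
  verts := G.verts
  mult u v := G.mult v u
  mem_verts u v h := (G.mem_verts v u h).symm

/-- Deletion of one edge from `x` to `y`. -/
def deleteEdge (G : MultiDigraph V) (x y : V) : MultiDigraph V :=
  ofMult G.verts fun u v => if u = x ∧ v = y then G.mult u v - 1 else G.mult u v

/-- The edge `(x, y)` is a strong bridge: its deletion splits some strongly connected component. -/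
def IsStrongBridge (G : MultiDigraph V) (x y : V) : Prop :=
  G.Adj x y ∧ ∃ u v, G.StronglyConn u v ∧ ¬ (G.deleteEdge x y).StronglyConn u v

/-! ### Flow graphs: dominators, bridges, marked vertices -/

/-- `p` is the list of vertices of a walk from `u` to `v`. -/
def IsWalk (G : MultiDigraph V) (u v : V) (p : List V) : Prop :=
  p.IsChain G.Adj ∧ p.head? = some u ∧ p.getLast? = some v

/-- In the flow graph with start vertex `s`, the vertex `u` dominates `v`. -/
def Dominates (G : MultiDigraph V) (s u v : V) : Prop :=
  ∀ p : List V, G.IsWalk s v p → u ∈ p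

/-- `u` is the immediate dominator of `v`: a proper dominator that all proper dominators dominate,
i.e. the parent of `v` in the dominator tree. -/
def IsIdom (G : MultiDigraph V) (s u v : V) : Prop :=
  u ≠ v ∧ G.Dominates s u v ∧ ∀ w, w ≠ v → G.Dominates s w v → G.Dominates s w u

/-- The immediate dominator `d(v)` in the flow graph with start vertex `s` (only meaningful for
`v ≠ s`; the value is `v` if there is none). -/
def idom (G : MultiDigraph V) (s v : V) : V :=
  if h : ∃ u, G.IsIdom s u v then h.choose else v

/-- `D(r)`: the vertices of the subtree of the dominator tree rooted at `r`. -/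
def domSubtree (G : MultiDigraph V) (s r : V) : Set V :=
  {v | v ∈ G.verts ∧ G.Dominates s r v}

/-- The edge `(x, y)` is a bridge of the flow graph: without it, `s` does not reach `y`. -/
def IsBridge (G : MultiDigraph V) (s x y : V) : Prop :=
  G.Adj x y ∧ ¬ (G.deleteEdge x y).Reach s y

/-- `z` is marked: it is the head of a bridge of the flow graph. -/
def Marked (G : MultiDigraph V) (s z : V) : Prop := ∃ x, G.IsBridge s x z

/-- `T(r)`: the vertices that stay connected with their ancestor `r` in the dominator tree after the
removal of all bridges, i.e. no marked vertex other than `r` lies on the tree path from `r` to them. -/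
def tree (G : MultiDigraph V) (s r : V) : Set V :=
  {v | v ∈ G.domSubtree s r ∧
    ∀ z ∈ G.domSubtree s r, G.Marked s z → z ≠ r → v ∉ G.domSubtree s z}

/-! ### The auxiliary graphs -/

/-- The vertex into which `v` is shrunk in `H(G_s, r)`: everything outside `D(r)` is shrunk into
`d(r)`; vertices of `T(r)` are kept; `D(z)` is shrunk into `z` for marked `z` with `d(z) ∈ T(r)`. -/
def shrink (G : MultiDigraph V) (s r v : V) : V :=
  if v ∉ G.domSubtree s r then G.idom s r
  else if v ∈ G.tree s r then v
  else if h : ∃ z, G.Marked s z ∧ G.idom s z ∈ G.tree s r ∧ v ∈ G.domSubtree s z then h.choose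
  else v

/-- The auxiliary graph `H(G_s, r)`: shrink as above, drop the self-loops, and turn multiple edges
into double edges. Its ordinary vertices are those of `G.tree s r`. -/
def aux [Fintype V] (G : MultiDigraph V) (s r : V) : MultiDigraph V :=
  ofMult (G.shrink s r '' G.verts) fun a b =>
    if a = b then 0
    else min 2 (∑ u : V, ∑ v : V,
      if G.shrink s r u = a ∧ G.shrink s r v = b then G.mult u v else 0)

/-- `H_{rr'} = H(H_r^R, r')`, where `H_r = H(G_s, r)`, and `H_r^R` has start vertex `r`. -/
def aux₂ [Fintype V] (G : MultiDigraph V) (s r r' : V) : MultiDigraph V :=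
  (G.aux s r).reverse.aux r r'

/-- The ordinary vertices of `H_{rr'}`: those ordinary both in `H_r` and in `H_{rr'} = H(H_r^R, r')`.
All other vertices of `H_{rr'}` are auxiliary. -/
def ordinary₂ [Fintype V] (G : MultiDigraph V) (s r r' : V) : Set V :=
  G.tree s r ∩ (G.aux s r).reverse.tree r r'

/-- The tail `d(r')` of the critical edge `(d(r'), r')` of `H_{rr'}`; here `d` refers to `H_r^R`. -/
def crit₂ [Fintype V] (G : MultiDigraph V) (s r r' : V) : V :=
  (G.aux s r).reverse.idom r r'

/-- All edges of `H_{rr}` leaving `d(r)` (immediate dominator of `r` in `G_s`) go to the vertex `x`,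
which is auxiliary in `H_r` but ordinary in `H_{rr}` as a vertex of `H(H_r^R, r)`. -/
def SoleExit [Fintype V] (G : MultiDigraph V) (s r x : V) : Prop :=
  x ∉ G.tree s r ∧ x ∈ (G.aux s r).reverse.tree r r ∧
    ∀ v, (G.aux₂ s r r).Adj (G.idom s r) v ↔ v = x

/-- Remove the vertex `d` and add a new edge `(r, x)`. -/
def bypass (G : MultiDigraph V) (d r x : V) : MultiDigraph V :=
  ofMult (G.verts \ {d}) fun u v => G.mult u v + if u = r ∧ v = x then 1 else 0

/-- The simplified graph: if all edges of `H_{rr}` leaving `d(r)` go to one vertex `x` as in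
`SoleExit`, then `d(r)` is removed and the edge `(r, x)` is added; otherwise it is `H_{rr}`. -/
def auxTilde [Fintype V] (G : MultiDigraph V) (s r : V) : MultiDigraph V :=
  if h : ∃ x, G.SoleExit s r x then (G.aux₂ s r r).bypass (G.idom s r) r h.choose
  else G.aux₂ s r r

/-- The graph `C'` that the `S`-operation on `G` and its strong bridge `(x, y)` produces from the
strongly connected component `C` of `G ∖ (x, y)`: the edges inside `C`; an edge `(u, x)` for every edge
of `G` leaving `C` at `u`; an edge `(y, v)` for every edge of `G` entering `C` at `v`; the edge `(x, y)`.
-/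
def sGraph [Fintype V] (G : MultiDigraph V) (x y : V) (C : Set V) : MultiDigraph V :=
  ofMult (C ∪ {x, y}) fun u v =>
    (if u ∈ C ∧ v ∈ C then G.mult u v else 0)
    + (if u ∈ C ∧ v = x then ∑ w : V, if w ∉ C then G.mult u w else 0 else 0)
    + (if u = y ∧ v ∈ C then ∑ w : V, if w ∉ C then G.mult w v else 0 else 0)
    + (if u = x ∧ v = y then 1 else 0)

/-- `C` is a strongly connected component of `H_{rr'} ∖ (d(r'), r')`. -/
def IsCritComp [Fintype V] (G : MultiDigraph V) (s r r' : V) (C : Set V) : Prop :=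
  C ∈ ((G.aux₂ s r r').deleteEdge (G.crit₂ s r r') r').sccs

/-- The member of `S(H_{rr'}, (d(r'), r'))` that corresponds to the component `C`. -/
def sAux [Fintype V] (G : MultiDigraph V) (s r r' : V) (C : Set V) : MultiDigraph V :=
  (G.aux₂ s r r').sGraph (G.crit₂ s r r') r' C

/-! ### The possible strongly connected components after the deletion of a strong bridge -/

/-- The strongly connected components of `H ∖ (x, y)` are `{x}` and the rest, or `{y}` and the rest,
or `{x}`, `{y}` and the rest, and the singled-out vertices are auxiliary, i.e. not in `O`. -/
def SplitsOff (H : MultiDigraph V) (O : Set V) (x y : V) : Prop :=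
  (x ∉ O ∧ (H.deleteEdge x y).sccs = {{x}, H.verts \ {x}}) ∨
  (y ∉ O ∧ (H.deleteEdge x y).sccs = {{y}, H.verts \ {y}}) ∨
  (x ∉ O ∧ y ∉ O ∧ (H.deleteEdge x y).sccs = {{x}, {y}, H.verts \ {x, y}})

/-- The degenerate four-vertex case for a graph obtained by the `S`-operation on an edge `(d, r')`:
the graph consists of the four vertices `x, y, d, r'`, the component it comes from is `{x, y}`, both
`x` and `y` are auxiliary, and each vertex is a component of `H ∖ (x, y)` by itself. -/
def FourSingletons (H : MultiDigraph V) (O C : Set V) (d r' x y : V) : Prop :=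
  C = {x, y} ∧ H.verts = {x, y, d, r'} ∧ H.verts.ncard = 4 ∧ x ∉ O ∧ y ∉ O ∧
    (H.deleteEdge x y).sccs = {{x}, {y}, {d}, {r'}}

/-- The two extra cases for the unsimplified graph `H_{rr}`, in which `d = d(r)` is split off too. -/
def SplitsOffWith (H : MultiDigraph V) (O : Set V) (d x y : V) : Prop :=
  x ∉ O ∧ d ∉ O ∧
    ((H.deleteEdge x y).sccs = {{x}, {d}, H.verts \ {x, d}} ∨
      (y ∉ O ∧ (H.deleteEdge x y).sccs = {{x}, {y}, {d}, H.verts \ {x, y, d}}))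

end

end MultiDigraph

/-! ### Reachability, dominators and bridges of a flow graph. -/

namespace MultiDigraph

open scoped Classical

variable {V : Type*} {G : MultiDigraph V} {s r u v w x y z : V}

/-! ### Edges, reachability, deletion of an edge -/

/-! The proof rests on reachability that survives the deletion of any single edge ("robust"
reachability). The root `r` robustly reaches every vertex of `T(r)`: an edge whose deletion cuts
such a vertex off from `r` would be a bridge whose head lies strictly between them in the dominator
tree (`reach_deleteEdge_of_mem_tree`). Every shrunken vertex `z` of `H(G_s, r)` has the single
in-neighbour `d(z)`, which lies in `T(r)`. Shrinking preserves robustness, since capping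
multiplicities at two keeps all that one deletion can detect (`exists_deleteEdge_lift`).

Applying this to `G_s` and then to `H_r^R` shows that a vertex of `H_{rr'}` other than `d(r')` is
reached from `r'` robustly, or is auxiliary and its only in-neighbour is so reached (`GoodIn`).
Dually, it robustly reaches the image of `r`, or is auxiliary and has an out-neighbour that does
(`GoodOut`); only the image of `d(r)` may fail this. The image of `r` is `r` if `r' = r`, and
`d(r')` otherwise.

If both properties hold with one base vertex, then after deleting `(x, y)` the base reaches
everything except possibly `y` and is reached by everything except possibly `x`, so only these two
can split off (`splitsOff_of_base`). This settles `H_{ss}`. In `H_{rr}` the vertex `d(r)` is entered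
only from `r`; if it is cut off from `r` and `x ≠ d(r)`, all its edges go to `x`, which is the extra
case, and bypassing `d(r)` removes that case.

For an `S`-graph, robustness passes from `H_{rr'}` to `C'`, and the critical edge `(d(r'), r')`
joins the two bases. The delicate case is a component containing neither end, when `r'` no longer
reaches `d(r')`: every robustly reached vertex of `C` must then be `x`, which forces `C` to be a
singleton or `{x, y}`, the latter giving four singletons (`splitsOff_or_four_sGraph_of_not_mem`). -/

theorem reflTransGen_imp {p q : V → V → Prop} (h : ∀ a b, p a b → q a b) {a b : V}
    (hab : Relation.ReflTransGen p a b) : Relation.ReflTransGen q a b :=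
  Relation.ReflTransGen.mono h a b hab

theorem Adj.left_mem (h : G.Adj u v) : u ∈ G.verts := (G.mem_verts u v (Nat.ne_of_gt h)).1

theorem Adj.right_mem (h : G.Adj u v) : v ∈ G.verts := (G.mem_verts u v (Nat.ne_of_gt h)).2

theorem Reach.mem (h : G.Reach u v) (hu : u ∈ G.verts) : v ∈ G.verts := by
  induction h with
  | refl => exact hu
  | tail _ h _ => exact h.right_mem

theorem deleteEdge_mult :
    (G.deleteEdge x y).mult u v = if u = x ∧ v = y then G.mult u v - 1 else G.mult u v := by
  have h := G.mem_verts u v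
  simp only [deleteEdge, ofMult]
  split_ifs <;> first | rfl | (by_contra hc; have := h (by omega); tauto)

theorem deleteEdge_adj :
    (G.deleteEdge x y).Adj u v ↔ G.Adj u v ∧ (u = x → v = y → 2 ≤ G.mult u v) := by
  unfold Adj
  rw [deleteEdge_mult]
  split_ifs with h
  · constructor
    · intro h'; exact ⟨by omega, fun _ _ => by omega⟩
    · intro h'; have := h'.2 h.1 h.2; omega
  · tauto

theorem deleteEdge_verts : (G.deleteEdge x y).verts = G.verts := rfl

theorem Adj.deleteEdge (h : G.Adj u v) (hne : u = x → v ≠ y) : (G.deleteEdge x y).Adj u v :=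
  deleteEdge_adj.2 ⟨h, fun h1 h2 => absurd h2 (hne h1)⟩

theorem Adj.of_deleteEdge (h : (G.deleteEdge x y).Adj u v) : G.Adj u v := (deleteEdge_adj.1 h).1

theorem IsStrongBridge.ne (h : G.IsStrongBridge x y) : x ≠ y := by
  rintro rfl
  obtain ⟨-, _, _, ⟨hu, hv, h1, h2⟩, h3⟩ := h
  have key : ∀ a b, G.Reach a b → (G.deleteEdge x x).Reach a b := by
    intro a b hab
    induction hab with
    | refl => exact .refl
    | @tail b c _ hbc ih =>
      by_cases hb : b = x ∧ c = x
      · rw [hb.2]; rw [hb.1] at ih; exact ih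
      · exact ih.tail (hbc.deleteEdge fun h1 h2 => hb ⟨h1, h2⟩)
  exact h3 ⟨hu, hv, key _ _ h1, key _ _ h2⟩

theorem reverse_adj : G.reverse.Adj u v ↔ G.Adj v u := Iff.rfl

theorem reverse_reach : G.reverse.Reach u v ↔ G.Reach v u := by
  unfold Reach
  rw [← Relation.reflTransGen_swap]
  rfl

theorem reverse_deleteEdge_adj :
    (G.reverse.deleteEdge x y).Adj u v ↔ (G.deleteEdge y x).Adj v u := by
  rw [deleteEdge_adj, deleteEdge_adj]
  exact and_congr Iff.rfl ⟨fun h h1 h2 => h h2 h1, fun h h1 h2 => h h2 h1⟩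

theorem reverse_deleteEdge_reach :
    (G.reverse.deleteEdge x y).Reach u v ↔ (G.deleteEdge y x).Reach v u := by
  rw [← reverse_reach]
  exact ⟨reflTransGen_imp fun _ _ => reverse_deleteEdge_adj.1,
    reflTransGen_imp fun _ _ => reverse_deleteEdge_adj.2⟩

theorem IsStronglyConnected.reach (h : G.IsStronglyConnected) (hu : u ∈ G.verts)
    (hv : v ∈ G.verts) : G.Reach u v := (h u hu v hv).2.2.1

theorem IsStronglyConnected.reverse (h : G.IsStronglyConnected) : G.reverse.IsStronglyConnected :=
  fun _ hu _ hv => ⟨hu, hv, reverse_reach.2 (h.reach hv hu), reverse_reach.2 (h.reach hu hv)⟩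

/-- `a` reaches `b` along a walk whose vertices after the first differ from `u`. -/
def ReachAvoid (G : MultiDigraph V) (u a b : V) : Prop :=
  Relation.ReflTransGen (fun a b => G.Adj a b ∧ b ≠ u) a b

theorem ReachAvoid.deleteEdge (h : G.ReachAvoid y v w) : (G.deleteEdge x y).Reach v w :=
  reflTransGen_imp (fun _ _ h => h.1.deleteEdge fun _ => h.2) h

/-! ### Dominators -/

/-- Replaces lists by a relation suited to induction. The guard `s ≠ u` is needed because
`ReachAvoid` does not constrain the first vertex. -/
theorem dominates_iff : G.Dominates s u v ↔ (s ≠ u → ¬ G.ReachAvoid u s v) := by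
  constructor
  · intro hd hsu hr
    have key : ∃ p : List V, G.IsWalk s v p ∧ u ∉ p := by
      clear hd
      induction hr with
      | refl => exact ⟨[s], by simp [IsWalk], by simpa using hsu.symm⟩
      | @tail b c _ hbc ih =>
        obtain ⟨p, ⟨h1, h2, h3⟩, h4⟩ := ih
        refine ⟨p ++ [c], ⟨?_, ?_, by simp⟩, by simp [h4, hbc.2.symm]⟩
        · rw [List.isChain_append]
          refine ⟨h1, by simp, ?_⟩
          intro a ha b' hb'
          simp only [h3, Option.mem_def, Option.some.injEq, List.head?_cons] at ha hb'
          subst ha; subst hb'; exact hbc.1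
        · rw [List.head?_append, h2]; rfl
    obtain ⟨p, hp, hu⟩ := key
    exact hu (hd p hp)
  · intro h p hp
    by_contra hu
    obtain ⟨h1, h2, h3⟩ := hp
    have key : ∀ (p : List V) (a : V), p.IsChain G.Adj → p.head? = some a → p.getLast? = some v →
        u ∉ p → G.ReachAvoid u a v := by
      intro p
      induction p with
      | nil => intro a _ h; simp at h
      | cons b q ih =>
        intro a hc hh hl hu
        simp only [List.head?_cons, Option.some.injEq] at hh
        subst hh
        cases q with
        | nil =>
          simp only [List.getLast?_singleton, Option.some.injEq] at hl
          subst hl; exact .refl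
        | cons c q =>
          rw [List.isChain_cons_cons] at hc
          rw [List.getLast?_cons_cons] at hl
          refine Relation.ReflTransGen.head ⟨hc.1, ?_⟩
            (ih c hc.2 rfl hl fun hm => hu (List.mem_cons_of_mem _ hm))
          rintro rfl
          exact hu (by simp)
    refine h ?_ (key p s h1 h2 h3 hu)
    rintro rfl
    cases p with
    | nil => simp at h2
    | cons b q => simp at h2; exact hu (by simp [h2])

theorem mem_domSubtree :
    v ∈ G.domSubtree s u ↔ v ∈ G.verts ∧ (s ≠ u → ¬ G.ReachAvoid u s v) := by
  rw [← dominates_iff]; rfl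

theorem not_mem_domSubtree (hv : v ∈ G.verts) :
    v ∉ G.domSubtree s u ↔ s ≠ u ∧ G.ReachAvoid u s v := by
  rw [mem_domSubtree]; tauto

theorem mem_domSubtree_self (hu : u ∈ G.verts) : u ∈ G.domSubtree s u := by
  refine mem_domSubtree.2 ⟨hu, fun hs h => ?_⟩
  cases h with
  | refl => exact hs rfl
  | tail _ h => exact h.2 rfl

theorem mem_domSubtree_start (hv : v ∈ G.verts) : v ∈ G.domSubtree s s :=
  mem_domSubtree.2 ⟨hv, fun h => absurd rfl h⟩

theorem start_not_mem_domSubtree (hs : s ∈ G.verts) (h : s ≠ u) : s ∉ G.domSubtree s u :=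
  (not_mem_domSubtree hs).2 ⟨h, .refl⟩

/-- Each vertex reachable from `s` is either reached without `u`, or lies in `D(u)` and is reached
from `u` inside `D(u)`. -/
theorem reach_within_domSubtree (hG : G.IsStronglyConnected) (hs : s ∈ G.verts)
    (hv : v ∈ G.domSubtree s u) :
    Relation.ReflTransGen (fun a b => G.Adj a b ∧ a ∈ G.domSubtree s u ∧ b ∈ G.domSubtree s u)
      u v := by
  have hr := hG.reach hs hv.1
  revert hv
  induction hr with
  | refl =>
    intro hv
    by_cases h : s = u
    · rw [h]
    · exact absurd hv (start_not_mem_domSubtree hs h)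
  | @tail b c hb hbc ih =>
    intro hc
    by_cases hbD : b ∈ G.domSubtree s u
    · exact (ih hbD).tail ⟨hbc, hbD, hc⟩
    · obtain ⟨h1, h2⟩ := (not_mem_domSubtree hbc.left_mem).1 hbD
      by_cases hcu : c = u
      · rw [hcu]
      · exact absurd (h2.tail ⟨hbc, hcu⟩) ((mem_domSubtree.1 hc).2 h1)

theorem domSubtree_trans (h : v ∈ G.domSubtree s u) (h' : w ∈ G.domSubtree s v) :
    w ∈ G.domSubtree s u := by
  refine mem_domSubtree.2 ⟨h'.1, fun hs hr => ?_⟩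
  by_cases hsv : s = v
  · subst hsv; exact (mem_domSubtree.1 h).2 hs .refl
  refine (mem_domSubtree.1 h').2 hsv ?_
  have key : ∀ c, G.ReachAvoid u s c → G.ReachAvoid v s c := by
    intro c hc
    induction hc with
    | refl => exact .refl
    | @tail b c hb hbc ih =>
      refine ih.tail ⟨hbc.1, ?_⟩
      rintro rfl
      exact (mem_domSubtree.1 h).2 hs (hb.tail hbc)
  exact key _ hr

/-- A walk from `s` cannot meet either of two distinct vertices first if each dominates the other,
so it meets neither. -/
theorem domSubtree_antisymm (hG : G.IsStronglyConnected) (hs : s ∈ G.verts)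
    (h : v ∈ G.domSubtree s u) (h' : u ∈ G.domSubtree s v) : u = v := by
  by_contra hne
  have key : ∀ c, G.Reach s c → c ≠ u ∧ c ≠ v := by
    intro c hc
    have : G.ReachAvoid u s c ∧ G.ReachAvoid v s c ∧ c ≠ u ∧ c ≠ v := by
      have hsu : s ≠ u := by
        rintro rfl
        exact start_not_mem_domSubtree hs hne h'
      have hsv : s ≠ v := by
        rintro rfl
        exact start_not_mem_domSubtree hs (Ne.symm hne) h
      induction hc with
      | refl => exact ⟨.refl, .refl, hsu, hsv⟩
      | @tail b c _ hbc ih =>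
        obtain ⟨h1, h2, h3, h4⟩ := ih
        have hcu : c ≠ u := by
          rintro rfl
          exact (mem_domSubtree.1 h').2 hsv (h2.tail ⟨hbc, hne⟩)
        have hcv : c ≠ v := by
          rintro rfl
          exact (mem_domSubtree.1 h).2 hsu (h1.tail ⟨hbc, Ne.symm hne⟩)
        exact ⟨h1.tail ⟨hbc, hcu⟩, h2.tail ⟨hbc, hcv⟩, hcu, hcv⟩
    exact this.2.2
  exact (key u (hG.reach hs h'.1)).1 rfl

/-- The dominators of a vertex form a chain. -/
theorem domSubtree_chain (hG : G.IsStronglyConnected) (hs : s ∈ G.verts) (hu : u ∈ G.verts)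
    (hw : w ∈ G.verts) (h : v ∈ G.domSubtree s u) (h' : v ∈ G.domSubtree s w) :
    w ∈ G.domSubtree s u ∨ u ∈ G.domSubtree s w := by
  by_contra! hc
  obtain ⟨hsu, h1⟩ := (not_mem_domSubtree hw).1 hc.1
  obtain ⟨hsw, h2⟩ := (not_mem_domSubtree hu).1 hc.2
  -- When a walk hits `u`, it is replaced by the walk to `u` that avoids `w`, and symmetrically at
  -- `w`.
  have key : ∀ c, G.Reach s c → G.ReachAvoid u s c ∨ G.ReachAvoid w s c := by
    intro c hc
    induction hc with
    | refl => exact .inl .refl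
    | @tail b c _ hbc ih =>
      by_cases hcu : c = u
      · subst hcu; exact .inr h2
      by_cases hcw : c = w
      · subst hcw; exact .inl h1
      exact ih.imp (·.tail ⟨hbc, hcu⟩) (·.tail ⟨hbc, hcw⟩)
  rcases key v (hG.reach hs h.1) with h3 | h3
  · exact (mem_domSubtree.1 h).2 hsu h3
  · exact (mem_domSubtree.1 h').2 hsw h3

/-! ### Bridges of a flow graph -/

theorem IsBridge.start_ne (h : G.IsBridge s x y) : s ≠ y := by
  rintro rfl; exact h.2 .refl

/-- A walk in `G ∖ (x, y)` from `s` never meets `y`, and a walk avoiding `y` never uses the edge. -/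
theorem IsBridge.mem_domSubtree_iff (h : G.IsBridge s x y) (hv : v ∈ G.verts) :
    v ∈ G.domSubtree s y ↔ ¬ (G.deleteEdge x y).Reach s v := by
  rw [mem_domSubtree]
  constructor
  · rintro ⟨-, h1⟩ h2
    refine h1 h.start_ne ?_
    clear h1 hv
    induction h2 with
    | refl => exact .refl
    | @tail b c hb hbc ih =>
      refine ih.tail ⟨hbc.of_deleteEdge, ?_⟩
      rintro rfl
      exact h.2 (hb.tail hbc)
  · intro h1
    exact ⟨hv, fun _ h2 => h1 h2.deleteEdge⟩

/-- A bridge is the only edge that enters the subtree of its head. -/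
theorem IsBridge.not_adj (h : G.IsBridge s x y)
    (hu : u ∉ G.domSubtree s y) (hv : v ∈ G.domSubtree s y) : ¬ (G.deleteEdge x y).Adj u v := by
  intro ha
  have hu' := ha.of_deleteEdge.left_mem
  rw [h.mem_domSubtree_iff hu', not_not] at hu
  exact (h.mem_domSubtree_iff hv.1).1 hv (hu.tail ha)

theorem IsBridge.eq_of_adj (h : G.IsBridge s x y)
    (hu : u ∉ G.domSubtree s y) (hv : v ∈ G.domSubtree s y) (ha : G.Adj u v) :
    u = x ∧ v = y := by
  by_contra hc
  exact h.not_adj hu hv (ha.deleteEdge fun h1 h2 => hc ⟨h1, h2⟩)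

/-- If the only edge entering `D(y)` started inside it, `D(y)` could never be entered from `s`. -/
theorem IsBridge.tail_not_mem (h : G.IsBridge s x y) (hG : G.IsStronglyConnected)
    (hs : s ∈ G.verts) : x ∉ G.domSubtree s y := by
  have key : ∀ c, G.Reach s c → c ∉ G.domSubtree s y ∨ x ∉ G.domSubtree s y := by
    intro c hc
    induction hc with
    | refl => exact .inl (start_not_mem_domSubtree hs h.start_ne)
    | @tail b c hb hbc ih =>
      rcases ih with ih | ih
      · by_cases hcD : c ∈ G.domSubtree s y
        · right
          rw [← (h.eq_of_adj ih hcD hbc).1]; exact ih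
        · exact .inl hcD
      · exact .inr ih
  have hy := h.1.right_mem
  exact (key y (hG.reach hs hy)).resolve_left fun h' => h' (mem_domSubtree_self hy)

theorem IsBridge.mult_le_one (h : G.IsBridge s x y) (hG : G.IsStronglyConnected)
    (hs : s ∈ G.verts) : G.mult x y ≤ 1 := by
  by_contra hc
  exact h.not_adj (h.tail_not_mem hG hs) (mem_domSubtree_self h.1.right_mem)
    (deleteEdge_adj.2 ⟨h.1, fun _ _ => by omega⟩)

/-- All walks into `D(y)` pass through `x`, and a walk to `x` that misses `w` extends by the bridge
to one reaching `y`. -/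
theorem IsBridge.isIdom (h : G.IsBridge s x y) (hG : G.IsStronglyConnected) (hs : s ∈ G.verts) :
    G.IsIdom s x y := by
  have hx := h.tail_not_mem hG hs
  have hy := mem_domSubtree_self (s := s) h.1.right_mem
  refine ⟨fun he => hx (he ▸ hy), dominates_iff.2 ?_, ?_⟩
  · intro hsx hr
    have key : ∀ c, G.ReachAvoid x s c → c ≠ x ∧ c ∉ G.domSubtree s y := by
      intro c hc
      induction hc with
      | refl => exact ⟨hsx, start_not_mem_domSubtree hs h.start_ne⟩
      | @tail b c hb hbc ih =>
        exact ⟨hbc.2, fun hcD => ih.1 (h.eq_of_adj ih.2 hcD hbc.1).1⟩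
    exact (key y hr).2 hy
  · intro w hw hd
    rw [dominates_iff] at hd ⊢
    exact fun hsw hr => hd hsw (hr.tail ⟨h.1, hw.symm⟩)

theorem IsIdom.unique (hG : G.IsStronglyConnected) (hs : s ∈ G.verts) (h : G.IsIdom s u v)
    (h' : G.IsIdom s w v) (hu : u ∈ G.verts) (hw : w ∈ G.verts) : u = w :=
  domSubtree_antisymm hG hs ⟨hw, h'.2.2 u h.1 h.2.1⟩ ⟨hu, h.2.2 w h'.1 h'.2.1⟩

theorem IsIdom.mem_verts (hG : G.IsStronglyConnected) (hs : s ∈ G.verts) (hv : v ∈ G.verts)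
    (h : G.IsIdom s u v) : u ∈ G.verts := by
  by_contra hu
  have hsu : s ≠ u := by rintro rfl; exact hu hs
  refine dominates_iff.1 h.2.1 hsu ?_
  refine reflTransGen_imp (fun a b hab => ⟨hab, ?_⟩) (hG.reach hs hv)
  rintro rfl
  exact hu hab.right_mem

theorem IsBridge.idom_eq (h : G.IsBridge s x y) (hG : G.IsStronglyConnected) (hs : s ∈ G.verts) :
    G.idom s y = x := by
  have hi := h.isIdom hG hs
  have hex : ∃ u, G.IsIdom s u y := ⟨x, hi⟩
  rw [idom, dif_pos hex]
  exact IsIdom.unique hG hs hex.choose_spec hi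
    (IsIdom.mem_verts hG hs h.1.right_mem hex.choose_spec) h.1.left_mem

theorem Marked.isBridge (h : G.Marked s z) (hG : G.IsStronglyConnected) (hs : s ∈ G.verts) :
    G.IsBridge s (G.idom s z) z := by
  obtain ⟨x, hx⟩ := h
  rw [hx.idom_eq hG hs]; exact hx

theorem Marked.mem_domSubtree_idom (h : G.Marked s z) (hG : G.IsStronglyConnected)
    (hs : s ∈ G.verts) (hw : z ∈ G.domSubtree s w) (hne : w ≠ z) :
    G.idom s z ∈ G.domSubtree s w :=
  ⟨(h.isBridge hG hs).1.left_mem, ((h.isBridge hG hs).isIdom hG hs).2.2 w hne hw.2⟩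

theorem Marked.mem_domSubtree_of_idom (h : G.Marked s z) (hG : G.IsStronglyConnected)
    (hs : s ∈ G.verts) : z ∈ G.domSubtree s (G.idom s z) :=
  ⟨(h.isBridge hG hs).1.right_mem, ((h.isBridge hG hs).isIdom hG hs).2.1⟩

end MultiDigraph

/-! ### A single auxiliary graph `H(G_s, r)`. -/

namespace MultiDigraph

open scoped Classical

variable {V : Type*} {G H : MultiDigraph V} {s r u v w x y z : V}

/-! ### The shrinking map -/

/-- `z` is a marked vertex into which `H(G_s, r)` shrinks its subtree `D(z)`. -/
def IsShrunk (G : MultiDigraph V) (s r z : V) : Prop :=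
  G.Marked s z ∧ G.idom s z ∈ G.tree s r

theorem tree_subset (h : v ∈ G.tree s r) : v ∈ G.domSubtree s r := h.1

theorem mem_tree_self (hG : G.IsStronglyConnected) (hs : s ∈ G.verts) (hr : r ∈ G.verts) :
    r ∈ G.tree s r :=
  ⟨mem_domSubtree_self hr, fun _ hz _ hne h => hne (domSubtree_antisymm hG hs h hz)⟩

theorem IsShrunk.mem_domSubtree (h : G.IsShrunk s r z) (hG : G.IsStronglyConnected)
    (hs : s ∈ G.verts) : z ∈ G.domSubtree s r :=
  domSubtree_trans h.2.1 (h.1.mem_domSubtree_of_idom hG hs)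

theorem IsShrunk.ne (h : G.IsShrunk s r z) (hG : G.IsStronglyConnected) (hs : s ∈ G.verts) :
    z ≠ r := by
  rintro rfl
  exact (h.1.isBridge hG hs).tail_not_mem hG hs h.2.1

theorem IsShrunk.not_mem_tree (h : G.IsShrunk s r z) (hG : G.IsStronglyConnected)
    (hs : s ∈ G.verts) (hv : v ∈ G.domSubtree s z) : v ∉ G.tree s r :=
  fun ht => ht.2 z (h.mem_domSubtree hG hs) h.1 (h.ne hG hs) hv

theorem IsShrunk.mem_verts (h : G.IsShrunk s r z) (hG : G.IsStronglyConnected)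
    (hs : s ∈ G.verts) : z ∈ G.verts := (h.mem_domSubtree hG hs).1

/-- Subtrees of shrunken vertices are never nested: if `D(a)` contained another such `b`, it would
contain `d(b)`, which lies in `T(r)`. -/
theorem IsShrunk.eq_of_mem (h : G.IsShrunk s r z) (h' : G.IsShrunk s r w)
    (hG : G.IsStronglyConnected) (hs : s ∈ G.verts) (hz : v ∈ G.domSubtree s z)
    (hw : v ∈ G.domSubtree s w) : z = w := by
  have aux : ∀ a b, G.IsShrunk s r a → G.IsShrunk s r b → b ∈ G.domSubtree s a → a = b := by
    intro a b ha hb hab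
    by_contra hne
    exact ha.not_mem_tree hG hs (hb.1.mem_domSubtree_idom hG hs hab hne) hb.2
  rcases domSubtree_chain hG hs (h.mem_verts hG hs) (h'.mem_verts hG hs) hz hw with hc | hc
  · exact aux z w h h' hc
  · exact (aux w z h' h hc).symm

theorem exists_isShrunk [Finite V] (hG : G.IsStronglyConnected) (hs : s ∈ G.verts)
    (hv : v ∈ G.domSubtree s r) (hT : v ∉ G.tree s r) :
    ∃ z, G.IsShrunk s r z ∧ v ∈ G.domSubtree s z := by
  let P : V → Prop := fun z => z ∈ G.domSubtree s r ∧ G.Marked s z ∧ z ≠ r ∧ v ∈ G.domSubtree s z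
  have hex : ∃ z, P z := by
    by_contra hc
    exact hT ⟨hv, fun z h1 h2 h3 h4 => hc ⟨z, h1, h2, h3, h4⟩⟩
  -- The largest subtree belongs to the topmost marked vertex above `v`. A marked vertex `w ≠ r` of
  -- `D(r)` dominating `d(z)` would have a strictly larger one, so `d(z)` lies in `T(r)`.
  obtain ⟨z, hz, hmax⟩ := Set.exists_max_image {z | P z} (fun z => (G.domSubtree s z).ncard)
    (Set.toFinite _) hex
  obtain ⟨h1, h2, h3, h4⟩ := hz
  refine ⟨z, ⟨h2, h2.mem_domSubtree_idom hG hs h1 h3.symm, fun w hw1 hw2 hw3 hw4 => ?_⟩, h4⟩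
  have hwz := domSubtree_trans hw4 (h2.mem_domSubtree_of_idom hG hs)
  have hle := hmax w ⟨hw1, hw2, hw3, domSubtree_trans hwz h4⟩
  refine absurd hle (not_le.2 (Set.ncard_lt_ncard ?_ (Set.toFinite _)))
  refine ⟨fun a ha => domSubtree_trans hwz ha, fun hsub => ?_⟩
  have hzw : z = w := domSubtree_antisymm hG hs (hsub (mem_domSubtree_self hw1.1)) hwz
  subst hzw
  exact (h2.isBridge hG hs).tail_not_mem hG hs hw4

theorem shrink_of_not_mem (hv : v ∉ G.domSubtree s r) : G.shrink s r v = G.idom s r := by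
  rw [shrink, if_pos hv]

theorem shrink_of_mem_tree (hv : v ∈ G.tree s r) : G.shrink s r v = v := by
  rw [shrink, if_neg (not_not.2 (tree_subset hv)), if_pos hv]

theorem IsShrunk.shrink_eq (h : G.IsShrunk s r z) (hG : G.IsStronglyConnected) (hs : s ∈ G.verts)
    (hv : v ∈ G.domSubtree s z) : G.shrink s r v = z := by
  have hex : ∃ z, G.Marked s z ∧ G.idom s z ∈ G.tree s r ∧ v ∈ G.domSubtree s z :=
    ⟨z, h.1, h.2, hv⟩
  rw [shrink, if_neg (not_not.2 (domSubtree_trans (h.mem_domSubtree hG hs) hv)),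
    if_neg (h.not_mem_tree hG hs hv), dif_pos hex]
  exact IsShrunk.eq_of_mem ⟨hex.choose_spec.1, hex.choose_spec.2.1⟩ h hG hs
    hex.choose_spec.2.2 hv

/-- `r` is a vertex for which `H(G_s, r)` is defined. -/
def IsRoot (G : MultiDigraph V) (s r : V) : Prop := r = s ∨ G.Marked s r

theorem IsRoot.mem_verts (h : G.IsRoot s r) (hs : s ∈ G.verts) : r ∈ G.verts := by
  rcases h with rfl | ⟨x, hx⟩
  · exact hs
  · exact hx.1.right_mem

theorem IsRoot.isBridge (h : G.IsRoot s r) (hG : G.IsStronglyConnected) (hs : s ∈ G.verts)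
    (hne : r ≠ s) : G.IsBridge s (G.idom s r) r := (h.resolve_left hne).isBridge hG hs

/-- The three kinds of vertices, with their images in `H(G_s, r)`. -/
theorem shrink_cases [Finite V] (hG : G.IsStronglyConnected) (hs : s ∈ G.verts)
    (hv : v ∈ G.verts) :
    (v ∈ G.tree s r ∧ G.shrink s r v = v) ∨
    (∃ z, G.IsShrunk s r z ∧ v ∈ G.domSubtree s z ∧ G.shrink s r v = z) ∨
    (r ≠ s ∧ v ∉ G.domSubtree s r ∧ G.shrink s r v = G.idom s r) := by
  by_cases hD : v ∈ G.domSubtree s r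
  · by_cases hT : v ∈ G.tree s r
    · exact .inl ⟨hT, shrink_of_mem_tree hT⟩
    · obtain ⟨z, hz, hvz⟩ := exists_isShrunk hG hs hD hT
      exact .inr (.inl ⟨z, hz, hvz, hz.shrink_eq hG hs hvz⟩)
  · refine .inr (.inr ⟨?_, hD, shrink_of_not_mem hD⟩)
    rintro rfl
    exact hD (mem_domSubtree_start hv)

theorem idom_not_mem_tree (hr : G.IsRoot s r) (hG : G.IsStronglyConnected) (hs : s ∈ G.verts)
    (hne : r ≠ s) : G.idom s r ∉ G.tree s r :=
  fun h => (hr.isBridge hG hs hne).tail_not_mem hG hs h.1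

theorem IsShrunk.ne_idom (h : G.IsShrunk s r z) (hr : G.IsRoot s r) (hG : G.IsStronglyConnected)
    (hs : s ∈ G.verts) (hne : r ≠ s) : z ≠ G.idom s r :=
  fun he => (hr.isBridge hG hs hne).tail_not_mem hG hs (he ▸ h.mem_domSubtree hG hs)

/-- With the next two lemmas this determines the fibres of `shrink`, so that edges of `H(G_s, r)`
can be traced back to `G`. -/
theorem eq_of_shrink_mem_tree [Finite V] (hr : G.IsRoot s r) (hG : G.IsStronglyConnected)
    (hs : s ∈ G.verts) (hv : v ∈ G.verts) (h : G.shrink s r v ∈ G.tree s r) :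
    G.shrink s r v = v := by
  rcases shrink_cases (r := r) hG hs hv with h' | ⟨z, hz, hvz, h'⟩ | ⟨hne, -, h'⟩
  · exact h'.2
  · rw [h'] at h
    exact absurd h (hz.not_mem_tree hG hs (mem_domSubtree_self (hz.mem_verts hG hs)))
  · rw [h'] at h
    exact absurd h (idom_not_mem_tree hr hG hs hne)

theorem mem_domSubtree_of_shrink_eq [Finite V] (hr : G.IsRoot s r) (hG : G.IsStronglyConnected)
    (hs : s ∈ G.verts) (hv : v ∈ G.verts) (hz : G.IsShrunk s r z) (h : G.shrink s r v = z) :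
    v ∈ G.domSubtree s z := by
  rcases shrink_cases (r := r) hG hs hv with h' | ⟨z', _, hvz, h'⟩ | ⟨hne, -, h'⟩
  · rw [← h'.2, h] at h'
    exact absurd h'.1 (hz.not_mem_tree hG hs (mem_domSubtree_self (hz.mem_verts hG hs)))
  · rw [← h, h']; exact hvz
  · exact absurd (h.symm.trans h') (hz.ne_idom hr hG hs hne)

theorem not_mem_domSubtree_of_shrink_eq [Finite V] (hr : G.IsRoot s r)
    (hG : G.IsStronglyConnected) (hs : s ∈ G.verts) (hv : v ∈ G.verts) (hne : r ≠ s)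
    (h : G.shrink s r v = G.idom s r) : v ∉ G.domSubtree s r := by
  rcases shrink_cases (r := r) hG hs hv with h' | ⟨z', hz, hvz, h'⟩ | ⟨-, h', -⟩
  · rw [← h'.2, h] at h'
    exact absurd h'.1 (idom_not_mem_tree hr hG hs hne)
  · exact absurd (h'.symm.trans h) (hz.ne_idom hr hG hs hne)
  · exact h'

/-! ### Robust reachability -/

/-- The root of a tree reaches each vertex of the tree after the deletion of any edge. -/
theorem reach_deleteEdge_of_mem_tree (hG : G.IsStronglyConnected) (hs : s ∈ G.verts)
    (hv : v ∈ G.tree s r) (x y : V) : (G.deleteEdge x y).Reach r v := by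
  by_contra hX
  have hvD := tree_subset hv
  have hin := reach_within_domSubtree hG hs hvD
  -- A walk from `s` either has not met `r` yet or can be restarted at `r`; hence if `r` loses `v`,
  -- so does `s`.
  have hor : ∀ c, (G.deleteEdge x y).Reach s c →
      (s ≠ r ∧ G.ReachAvoid r s c) ∨ (G.deleteEdge x y).Reach r c := by
    intro c hc
    induction hc with
    | refl =>
      by_cases hsr : s = r
      · subst hsr; exact .inr .refl
      · exact .inl ⟨hsr, .refl⟩
    | @tail b c _ hbc ih =>
      by_cases hcr : c = r
      · subst hcr; exact .inr .refl
      rcases ih with ih | ih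
      · exact .inl ⟨ih.1, ih.2.tail ⟨hbc.of_deleteEdge, hcr⟩⟩
      · exact .inr (ih.tail hbc)
  have hsv : ¬ (G.deleteEdge x y).Reach s v := fun h =>
    (hor v h).elim (fun h => (mem_domSubtree.1 hvD).2 h.1 h.2) hX
  have hyD : y ∈ G.domSubtree s r ∧ G.Adj x y := by
    by_contra hc
    refine hX (reflTransGen_imp (fun a b hab => hab.1.deleteEdge ?_) hin)
    rintro rfl rfl
    exact hc ⟨hab.2.2, hab.1⟩
  have hyr : y ≠ r := by
    rintro rfl
    have key : ∀ c, G.Reach y c → (G.deleteEdge x y).Reach y c := by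
      intro c hc
      induction hc with
      | refl => exact .refl
      | @tail b c _ hbc ih =>
        by_cases hcy : c = y
        · rw [hcy]; exact .refl
        · exact ih.tail (hbc.deleteEdge fun _ => hcy)
    exact hX (key v (hG.reach hyD.1.1 hvD.1))
  -- If `s` still reached `y`, the deleted edge would be dispensable for everything reachable from
  -- `s`. So `(x, y)` is a bridge with `v ∈ D(y)`, contradicting `v ∈ T(r)`.
  have hsy : ¬ (G.deleteEdge x y).Reach s y := by
    intro hsy
    have key : ∀ c, G.Reach s c → (G.deleteEdge x y).Reach s c := by
      intro c hc
      induction hc with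
      | refl => exact .refl
      | @tail b c _ hbc ih =>
        by_cases hcy : c = y
        · rw [hcy]; exact hsy
        · exact ih.tail (hbc.deleteEdge fun _ => hcy)
    exact hsv (key v (hG.reach hs hvD.1))
  have hb : G.IsBridge s x y := ⟨hyD.2, hsy⟩
  exact hv.2 y hyD.1 ⟨x, hb⟩ hyr ((hb.mem_domSubtree_iff hvD.1).2 hsv)

/-- `b` reaches `v` after the deletion of any edge. -/
def RobustFrom (G : MultiDigraph V) (b v : V) : Prop := ∀ x y, (G.deleteEdge x y).Reach b v

/-- `v` reaches `b` after the deletion of any edge. -/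
def RobustTo (G : MultiDigraph V) (b v : V) : Prop := ∀ x y, (G.deleteEdge x y).Reach v b

/-- `v` is robustly reached from `b`, or it is not in `O` and its only in-neighbour is so reached. -/
def GoodIn (G : MultiDigraph V) (b : V) (O : Set V) (v : V) : Prop :=
  G.RobustFrom b v ∨ (v ∉ O ∧ ∃ w, G.RobustFrom b w ∧ G.Adj w v ∧ ∀ u, G.Adj u v → u = w)

/-- `v` robustly reaches `b`, or it is not in `O` and has an out-neighbour that does. -/
def GoodOut (G : MultiDigraph V) (b : V) (O : Set V) (v : V) : Prop :=
  G.RobustTo b v ∨ (v ∉ O ∧ ∃ w, G.RobustTo b w ∧ G.Adj v w)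

/-! ### Edges under maps between multigraphs -/

/-- If the edges in `R` are mapped by `φ` to edges, without merging multiplicities beyond double
edges, then the deletion of an edge of the target is matched by that of an edge of the source. -/
theorem exists_deleteEdge_lift (R : V → V → Prop) (φ : V → V → V × V)
    (h1 : ∀ u v, R u v → G.Adj u v → H.Adj (φ u v).1 (φ u v).2)
    (h2 : ∀ u v, R u v → 2 ≤ G.mult u v → 2 ≤ H.mult (φ u v).1 (φ u v).2)
    (h3 : ∀ u v u' v', R u v → R u' v' → G.Adj u v → G.Adj u' v' → φ u v = φ u' v' →
      (u, v) ≠ (u', v') → 2 ≤ H.mult (φ u v).1 (φ u v).2) (x y : V) :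
    ∃ x' y', ∀ u v, R u v → (G.deleteEdge x' y').Adj u v →
      (H.deleteEdge x y).Adj (φ u v).1 (φ u v).2 := by
  by_cases hex : ∃ x' y', R x' y' ∧ G.Adj x' y' ∧ φ x' y' = (x, y)
  · obtain ⟨x', y', hR, hA, hφ⟩ := hex
    refine ⟨x', y', fun u v hu ha => ?_⟩
    rw [deleteEdge_adj] at ha ⊢
    refine ⟨h1 u v hu ha.1, fun hx hy => ?_⟩
    by_cases he : u = x' ∧ v = y'
    · exact h2 u v hu (ha.2 he.1 he.2)
    · refine h3 u v x' y' hu hR ha.1 hA ?_ fun h => he (Prod.mk.inj h)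
      rw [hφ, ← hx, ← hy]
  · refine ⟨x, y, fun u v hu ha => ?_⟩
    rw [deleteEdge_adj] at ha ⊢
    exact ⟨h1 u v hu ha.1, fun hx hy => absurd ⟨u, v, hu, ha.1, Prod.ext hx hy⟩ hex⟩

theorem two_le_sum {ι : Type*} {t : Finset ι} {f : ι → ℕ} {i j : ι} (hi : i ∈ t) (hj : j ∈ t)
    (hij : i ≠ j) (hfi : 0 < f i) (hfj : 0 < f j) : 2 ≤ ∑ k ∈ t, f k := by
  have h : ∑ k ∈ ({i, j} : Finset ι), f k ≤ ∑ k ∈ t, f k := by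
    refine Finset.sum_le_sum_of_subset fun k hk => ?_
    rcases Finset.mem_insert.1 hk with rfl | hk
    · exact hi
    · rw [Finset.mem_singleton.1 hk]; exact hj
  rw [Finset.sum_pair hij] at h
  omega

/-! ### The auxiliary graph -/

variable [Fintype V]

/-- The number of edges of `G` from the vertices shrunk into `a` to those shrunk into `b`. -/
noncomputable def shrinkCount (G : MultiDigraph V) (s r a b : V) : ℕ :=
  ∑ p : V × V, if G.shrink s r p.1 = a ∧ G.shrink s r p.2 = b then G.mult p.1 p.2 else 0

theorem aux_mult {a b : V} (hab : a ≠ b) :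
    (G.aux s r).mult a b = min 2 (G.shrinkCount s r a b) := by
  have hsum : (∑ u : V, ∑ v : V,
      if G.shrink s r u = a ∧ G.shrink s r v = b then G.mult u v else 0) =
      G.shrinkCount s r a b := by
    rw [shrinkCount, Fintype.sum_prod_type]
  simp only [aux, ofMult, if_neg hab, hsum]
  split_ifs with h
  · rfl
  -- The restriction to the vertex set in `ofMult` discards nothing.
  · have : G.shrinkCount s r a b = 0 := by
      refine Finset.sum_eq_zero fun p _ => ?_
      split_ifs with hp
      · by_contra hc
        have := G.mem_verts _ _ hc
        exact h ⟨⟨_, this.1, hp.1⟩, ⟨_, this.2, hp.2⟩⟩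
      · rfl
    omega

theorem mult_le_shrinkCount (u v : V) :
    G.mult u v ≤ G.shrinkCount s r (G.shrink s r u) (G.shrink s r v) := by
  refine le_trans (le_of_eq ?_) (Finset.single_le_sum (fun _ _ => Nat.zero_le _)
    (Finset.mem_univ (u, v)))
  simp

theorem aux_not_adj_self : ¬ (G.aux s r).Adj v v := by
  simp [Adj, aux, ofMult]

theorem aux_adj_of_adj (h : G.Adj u v) (hne : G.shrink s r u ≠ G.shrink s r v) :
    (G.aux s r).Adj (G.shrink s r u) (G.shrink s r v) := by
  have := mult_le_shrinkCount (G := G) (s := s) (r := r) u v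
  unfold Adj at *
  rw [aux_mult hne]
  omega

theorem exists_adj_of_aux_adj (h : (G.aux s r).Adj u v) :
    ∃ a b, G.Adj a b ∧ G.shrink s r a = u ∧ G.shrink s r b = v := by
  have hne : u ≠ v := by rintro rfl; exact aux_not_adj_self h
  unfold Adj at h
  rw [aux_mult hne] at h
  have : G.shrinkCount s r u v ≠ 0 := by omega
  obtain ⟨p, -, hp⟩ := Finset.exists_ne_zero_of_sum_ne_zero this
  by_cases hc : G.shrink s r p.1 = u ∧ G.shrink s r p.2 = v
  · rw [if_pos hc] at hp
    exact ⟨p.1, p.2, Nat.pos_of_ne_zero hp, hc⟩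
  · rw [if_neg hc] at hp
    exact absurd rfl hp

/-- Used to show that the images of bridges are still single edges. -/
theorem aux_mult_le_one
    (h : ∀ a b, G.Adj a b → G.shrink s r a = u → G.shrink s r b = v → a = x ∧ b = y)
    (hxy : G.mult x y ≤ 1) : (G.aux s r).mult u v ≤ 1 := by
  by_cases huv : u = v
  · subst huv
    have := aux_not_adj_self (G := G) (s := s) (r := r) (v := u)
    unfold Adj at this
    omega
  rw [aux_mult huv]
  refine le_trans (min_le_right _ _) ?_
  rw [shrinkCount, Finset.sum_eq_single (x, y)]
  · split_ifs <;> simp [hxy]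
  · intro p _ hp
    split_ifs with hc
    · by_contra h0
      have := h p.1 p.2 (Nat.pos_of_ne_zero h0) hc.1 hc.2
      exact hp (Prod.ext this.1 this.2)
    · rfl
  · simp

/-- Two distinct edges of `G` with the same non-loop image give a double edge, of which one copy
survives. Edges that become loops only join vertices with equal images. -/
theorem aux_deleteEdge_lift (s r x y : V) : ∃ x' y', ∀ u v, (G.deleteEdge x' y').Reach u v →
    ((G.aux s r).deleteEdge x y).Reach (G.shrink s r u) (G.shrink s r v) := by
  obtain ⟨x', y', h⟩ := exists_deleteEdge_lift (G := G) (H := G.aux s r)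
    (fun u v => G.shrink s r u ≠ G.shrink s r v) (fun u v => (G.shrink s r u, G.shrink s r v))
    (fun u v hne h => aux_adj_of_adj h hne)
    (fun u v hne h => by
      have := mult_le_shrinkCount (G := G) (s := s) (r := r) u v
      simp only [aux_mult hne]
      omega)
    (fun u v u' v' hne _ h h' he hp => by
      simp only [aux_mult hne]
      refine le_min le_rfl (two_le_sum (Finset.mem_univ (u, v)) (Finset.mem_univ (u', v')) hp ?_ ?_)
      · simpa [Adj] using h
      · simp only [Prod.mk.injEq] at he
        simpa [he.1, he.2, Adj] using h')
    x y
  refine ⟨x', y', fun u v huv => ?_⟩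
  induction huv with
  | refl => exact .refl
  | @tail b c _ hbc ih =>
    by_cases he : G.shrink s r b = G.shrink s r c
    · rw [← he]; exact ih
    · exact ih.tail (h b c he hbc)

theorem aux_isStronglyConnected (hG : G.IsStronglyConnected) :
    (G.aux s r).IsStronglyConnected := by
  have key : ∀ u v, G.Reach u v → (G.aux s r).Reach (G.shrink s r u) (G.shrink s r v) := by
    intro u v huv
    induction huv with
    | refl => exact .refl
    | @tail b c _ hbc ih =>
      by_cases he : G.shrink s r b = G.shrink s r c
      · rw [← he]; exact ih
      · exact ih.tail (aux_adj_of_adj hbc he)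
  rintro _ ⟨u, hu, rfl⟩ _ ⟨v, hv, rfl⟩
  exact ⟨⟨u, hu, rfl⟩, ⟨v, hv, rfl⟩, key _ _ (hG.reach hu hv), key _ _ (hG.reach hv hu)⟩

theorem aux_robustFrom (hG : G.IsStronglyConnected) (hs : s ∈ G.verts) (hr : G.IsRoot s r)
    (hv : v ∈ G.tree s r) : (G.aux s r).RobustFrom r v := by
  intro x y
  obtain ⟨x', y', h⟩ := aux_deleteEdge_lift (G := G) s r x y
  have := h r v (reach_deleteEdge_of_mem_tree hG hs hv x' y')
  rwa [shrink_of_mem_tree hv, shrink_of_mem_tree (mem_tree_self hG hs (hr.mem_verts hs))] at this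

/-- In `H(G_s, r)`, a shrunken vertex `z` has the only in-neighbour `d(z)`. -/
theorem IsShrunk.adj_iff (h : G.IsShrunk s r z) (hr : G.IsRoot s r) (hG : G.IsStronglyConnected)
    (hs : s ∈ G.verts) : (G.aux s r).Adj u z ↔ u = G.idom s z := by
  have hb := h.1.isBridge hG hs
  have hzv := h.mem_verts hG hs
  have hz : G.shrink s r z = z := h.shrink_eq hG hs (mem_domSubtree_self hzv)
  have hd := shrink_of_mem_tree h.2
  constructor
  · intro hu
    obtain ⟨a, b, hab, rfl, hbz⟩ := exists_adj_of_aux_adj hu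
    have hbD := mem_domSubtree_of_shrink_eq hr hG hs hab.right_mem h hbz
    have haD : a ∉ G.domSubtree s z := fun haD => by
      rw [h.shrink_eq hG hs haD] at hu
      exact aux_not_adj_self hu
    rw [(hb.eq_of_adj haD hbD hab).1, hd]
  · rintro rfl
    have := aux_adj_of_adj (s := s) (r := r) hb.1 (by
      rw [hz, hd]; rintro he
      exact h.not_mem_tree hG hs (mem_domSubtree_self hzv) (he ▸ h.2))
    rwa [hz, hd] at this

theorem IsShrunk.mult_le_one (h : G.IsShrunk s r z) (hr : G.IsRoot s r)
    (hG : G.IsStronglyConnected) (hs : s ∈ G.verts) :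
    (G.aux s r).mult (G.idom s z) z ≤ 1 := by
  have hb := h.1.isBridge hG hs
  refine aux_mult_le_one (x := G.idom s z) (y := z) (fun a b hab ha hbz => ?_)
    (hb.mult_le_one hG hs)
  refine hb.eq_of_adj (fun haD => ?_) (mem_domSubtree_of_shrink_eq hr hG hs hab.right_mem h hbz)
    hab
  rw [h.shrink_eq hG hs haD] at ha
  exact hb.tail_not_mem hG hs (ha ▸ mem_domSubtree_self (h.mem_verts hG hs))

/-- In `H(G_s, r)`, the vertex `d(r)` has the only out-neighbour `r`. -/
theorem aux_idom_adj_iff (hr : G.IsRoot s r) (hG : G.IsStronglyConnected)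
    (hs : s ∈ G.verts) (hne : r ≠ s) : (G.aux s r).Adj (G.idom s r) v ↔ v = r := by
  have hb := hr.isBridge hG hs hne
  have hrT := shrink_of_mem_tree (mem_tree_self hG hs (hr.mem_verts hs))
  have hd := shrink_of_not_mem (hb.tail_not_mem hG hs)
  constructor
  · intro hv
    obtain ⟨a, b, hab, ha, rfl⟩ := exists_adj_of_aux_adj hv
    have haD := not_mem_domSubtree_of_shrink_eq hr hG hs hab.left_mem hne ha
    have hbD : b ∈ G.domSubtree s r := by
      by_contra hbD
      rw [shrink_of_not_mem hbD] at hv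
      exact aux_not_adj_self hv
    rw [(hb.eq_of_adj haD hbD hab).2, hrT]
  · rintro rfl
    have := aux_adj_of_adj (s := s) (r := v) hb.1 (by
      rw [hrT, hd]; exact (hb.isIdom hG hs).1)
    rwa [hrT, hd] at this

theorem aux_idom_mult_le_one (hr : G.IsRoot s r) (hG : G.IsStronglyConnected)
    (hs : s ∈ G.verts) (hne : r ≠ s) : (G.aux s r).mult (G.idom s r) r ≤ 1 := by
  have hb := hr.isBridge hG hs hne
  refine aux_mult_le_one (x := G.idom s r) (y := r) (fun a b hab ha hbr => ?_)
    (hb.mult_le_one hG hs)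
  have hrT := mem_tree_self hG hs (hr.mem_verts hs)
  refine hb.eq_of_adj (not_mem_domSubtree_of_shrink_eq hr hG hs hab.left_mem hne ha) ?_ hab
  rw [← eq_of_shrink_mem_tree hr hG hs hab.right_mem (by rw [hbr]; exact hrT), hbr]
  exact mem_domSubtree_self (hr.mem_verts hs)

theorem aux_verts_cases (hG : G.IsStronglyConnected) (hs : s ∈ G.verts)
    (hv : v ∈ (G.aux s r).verts) :
    v ∈ G.tree s r ∨ G.IsShrunk s r v ∨ (r ≠ s ∧ v = G.idom s r) := by
  obtain ⟨u, hu, rfl⟩ := hv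
  rcases shrink_cases (r := r) hG hs hu with h | ⟨z, hz, _, h⟩ | ⟨hne, -, h⟩
  · rw [h.2]; exact .inl h.1
  · rw [h]; exact .inr (.inl hz)
  · exact .inr (.inr ⟨hne, h⟩)

theorem root_mem_aux (hG : G.IsStronglyConnected) (hs : s ∈ G.verts) (hr : G.IsRoot s r) :
    r ∈ (G.aux s r).verts :=
  ⟨r, hr.mem_verts hs, shrink_of_mem_tree (mem_tree_self hG hs (hr.mem_verts hs))⟩

end MultiDigraph

/-! ### Splitting by a strong bridge, seen from a base vertex, and the bypass of `d(r)`. -/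

namespace MultiDigraph

open scoped Classical

variable {V : Type*} {G H : MultiDigraph V} {O : Set V} {a b d r u v w x y z : V}

/-! ### Components from a base vertex -/

theorem StronglyConn.refl (h : v ∈ G.verts) : G.StronglyConn v v := ⟨h, h, .refl, .refl⟩

theorem StronglyConn.symm (h : G.StronglyConn u v) : G.StronglyConn v u :=
  ⟨h.2.1, h.1, h.2.2.2, h.2.2.1⟩

theorem StronglyConn.trans (h : G.StronglyConn u v) (h' : G.StronglyConn v w) :
    G.StronglyConn u w :=
  ⟨h.1, h'.2.1, h.2.2.1.trans h'.2.2.1, h'.2.2.2.trans h.2.2.2⟩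

/-- If the vertices outside `B` form one component and those of `B` are components by themselves,
these are all components. -/
theorem sccs_eq {B : Set V} (hb : b ∈ G.verts) (hbB : b ∉ B) (hB : B ⊆ G.verts)
    (h1 : ∀ v ∈ G.verts, v ∉ B → G.StronglyConn v b)
    (h2 : ∀ v ∈ B, ∀ u, G.StronglyConn u v → u = v) :
    G.sccs = insert (G.verts \ B) ((fun v => {v}) '' B) := by
  have hsing : ∀ v ∈ B, {u | G.StronglyConn u v} = {v} := fun v hv => by
    ext u
    simp only [Set.mem_ofPred_eq, Set.mem_singleton_iff]
    exact ⟨h2 v hv u, fun h => by rw [h]; exact .refl (hB hv)⟩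
  have hrest : ∀ v ∈ G.verts, v ∉ B → {u | G.StronglyConn u v} = G.verts \ B := by
    intro v hv hvB
    ext u
    simp only [Set.mem_ofPred_eq, Set.mem_sdiff]
    refine ⟨fun h => ⟨h.1, fun huB => hvB ?_⟩, fun h => (h1 u h.1 h.2).trans (h1 v hv hvB).symm⟩
    rw [h2 u huB v h.symm]; exact huB
  ext C
  simp only [sccs, Set.mem_ofPred_eq, Set.mem_insert_iff, Set.mem_image]
  constructor
  · rintro ⟨v, hv, rfl⟩
    by_cases hvB : v ∈ B
    · exact .inr ⟨v, hvB, (hsing v hvB).symm⟩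
    · exact .inl (hrest v hv hvB)
  · rintro (rfl | ⟨v, hv, rfl⟩)
    · exact ⟨b, hb, (hrest b hb hbB).symm⟩
    · exact ⟨v, hB hv, (hsing v hv).symm⟩

theorem sccs_eq_one (hb : b ∈ G.verts) (hu : u ∈ G.verts) (hbu : b ≠ u)
    (h1 : ∀ v ∈ G.verts, v ≠ u → G.StronglyConn v b)
    (h2 : ∀ v, G.StronglyConn v u → v = u) : G.sccs = {{u}, G.verts \ {u}} := by
  rw [sccs_eq (B := {u}) hb (by simpa using hbu) (by simpa using hu) (by simpa using h1)
    (by simpa using h2), Set.image_singleton, Set.pair_comm]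

theorem sccs_eq_two (hb : b ∈ G.verts) (hu : u ∈ G.verts) (hv : v ∈ G.verts) (hbu : b ≠ u)
    (hbv : b ≠ v) (h1 : ∀ w ∈ G.verts, w ≠ u → w ≠ v → G.StronglyConn w b)
    (h2 : ∀ w, G.StronglyConn w u → w = u) (h3 : ∀ w, G.StronglyConn w v → w = v) :
    G.sccs = {{u}, {v}, G.verts \ {u, v}} := by
  rw [sccs_eq (B := {u, v}) hb (by simp [hbu, hbv]) (by simp [Set.insert_subset_iff, hu, hv])
    (by simpa using h1) (by simpa using ⟨h2, h3⟩)]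
  ext C
  simp only [Set.mem_insert_iff, Set.mem_image, Set.mem_singleton_iff, exists_eq_or_imp,
    exists_eq_left]
  tauto

theorem sccs_eq_three (hb : b ∈ G.verts) (hu : u ∈ G.verts) (hv : v ∈ G.verts)
    (hw : w ∈ G.verts) (hbu : b ≠ u) (hbv : b ≠ v) (hbw : b ≠ w)
    (h1 : ∀ c ∈ G.verts, c ≠ u → c ≠ v → c ≠ w → G.StronglyConn c b)
    (h2 : ∀ c, G.StronglyConn c u → c = u) (h3 : ∀ c, G.StronglyConn c v → c = v)
    (h4 : ∀ c, G.StronglyConn c w → c = w) :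
    G.sccs = {{u}, {v}, {w}, G.verts \ {u, v, w}} := by
  rw [sccs_eq (B := {u, v, w}) hb (by simp [hbu, hbv, hbw])
    (by simp [Set.insert_subset_iff, hu, hv, hw])
    (by simpa using h1) (by simpa using ⟨h2, h3, h4⟩)]
  ext C
  simp only [Set.mem_insert_iff, Set.mem_image, Set.mem_singleton_iff, exists_eq_or_imp,
    exists_eq_left]
  tauto

theorem eq_of_stronglyConn_of_not_adj_from (h : ∀ w, w ≠ v → ¬ G.Adj v w)
    (hu : G.StronglyConn u v) : u = v := by
  have key : ∀ c, G.Reach v c → c = v := by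
    intro c hc
    induction hc with
    | refl => rfl
    | @tail e c _ hec ih =>
      by_contra hne
      rw [ih] at hec
      exact h c hne hec
  exact key u hu.2.2.2

theorem eq_of_stronglyConn_of_not_adj_to (h : ∀ w, w ≠ v → ¬ G.Adj w v)
    (hu : G.StronglyConn u v) : u = v := by
  have key : ∀ c, G.Reach u c → c = v → u = v := by
    intro c hc
    induction hc with
    | refl => exact id
    | @tail e c _ hec ih =>
      intro hcv
      rw [hcv] at hec
      by_contra hne
      exact h e (fun he => hne (ih he)) hec
  exact key v hu.2.2.1 rfl

/-- If, after the deletion of a strong bridge `(x, y)`, the base vertex `b` reaches everything but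
possibly `y` and is reached by everything but possibly `x`, then at most `x`, `y` are split off. -/
theorem splitsOff_of_base (hb : b ∈ H.verts) (he : H.IsStrongBridge x y)
    (hin : ∀ v ∈ H.verts, (H.deleteEdge x y).Reach b v ∨ (v = y ∧ y ∉ O))
    (hout : ∀ v ∈ H.verts, (H.deleteEdge x y).Reach v b ∨ (v = x ∧ x ∉ O)) :
    H.SplitsOff O x y := by
  have hx := he.1.left_mem
  have hy := he.1.right_mem
  have hne := he.ne
  -- Every out-neighbour of `x` other than `x` still reaches `b`, so if `x` does not, it has none
  -- left. The argument for `y` is dual.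
  have hsx : ¬ (H.deleteEdge x y).Reach x b → ∀ v, (H.deleteEdge x y).StronglyConn v x → v = x := by
    intro hxb v
    refine eq_of_stronglyConn_of_not_adj_from fun w hw ha => hxb ?_
    rcases hout w ha.right_mem with h | h
    · exact .head ha h
    · exact absurd h.1 hw
  have hsy : ¬ (H.deleteEdge x y).Reach b y → ∀ v, (H.deleteEdge x y).StronglyConn v y → v = y := by
    intro hby v
    refine eq_of_stronglyConn_of_not_adj_to fun w hw ha => hby ?_
    rcases hin w ha.left_mem with h | h
    · exact .tail h ha
    · exact absurd h.1 hw
  have hsc : ∀ v ∈ H.verts, (v = x → (H.deleteEdge x y).Reach x b) →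
      (v = y → (H.deleteEdge x y).Reach b y) → (H.deleteEdge x y).StronglyConn v b := by
    intro v hv h1 h2
    refine ⟨hv, hb, ?_, ?_⟩
    · rcases hout v hv with h | h
      · exact h
      · rw [h.1]; exact h1 h.1
    · rcases hin v hv with h | h
      · exact h
      · rw [h.1]; exact h2 h.1
  by_cases h1 : (H.deleteEdge x y).Reach x b <;> by_cases h2 : (H.deleteEdge x y).Reach b y
  · obtain ⟨-, u, v, huv, hn⟩ := he
    exact absurd ((hsc u huv.1 (fun _ => h1) fun _ => h2).trans
      (hsc v huv.2.1 (fun _ => h1) fun _ => h2).symm) hn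
  · refine .inr (.inl ⟨((hin y hy).resolve_left h2).2, sccs_eq_one hb hy ?_ ?_ (hsy h2)⟩)
    · rintro rfl; exact h2 .refl
    · exact fun v hv hvy => hsc v hv (fun _ => h1) fun h => absurd h hvy
  · refine .inl ⟨((hout x hx).resolve_left h1).2, sccs_eq_one hb hx ?_ ?_ (hsx h1)⟩
    · rintro rfl; exact h1 .refl
    · exact fun v hv hvx => hsc v hv (fun h => absurd h hvx) fun _ => h2
  · refine .inr (.inr ⟨((hout x hx).resolve_left h1).2, ((hin y hy).resolve_left h2).2,
      sccs_eq_two hb hx hy ?_ ?_ ?_ (hsx h1) (hsy h2)⟩)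
    · rintro rfl; exact h1 .refl
    · rintro rfl; exact h2 .refl
    · exact fun v hv hvx hvy => hsc v hv (fun h => absurd h hvx) fun h => absurd h hvy

theorem GoodIn.reach_or (h : H.GoodIn b O v) (x y : V) :
    (H.deleteEdge x y).Reach b v ∨ (v = y ∧ y ∉ O) := by
  rcases h with h | ⟨hO, w, hw, ha, -⟩
  · exact .inl (h x y)
  · by_cases he : w = x ∧ v = y
    · exact .inr ⟨he.2, he.2 ▸ hO⟩
    · exact .inl ((hw x y).tail (ha.deleteEdge fun h1 h2 => he ⟨h1, h2⟩))

theorem GoodOut.reach_or (h : H.GoodOut b O v) (x y : V) :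
    (H.deleteEdge x y).Reach v b ∨ (v = x ∧ x ∉ O) := by
  rcases h with h | ⟨hO, w, hw, ha⟩
  · exact .inl (h x y)
  · by_cases he : v = x ∧ w = y
    · exact .inr ⟨he.1, he.1 ▸ hO⟩
    · exact .inl (.head (ha.deleteEdge fun h1 h2 => he ⟨h1, h2⟩) (hw x y))

theorem splitsOff_of_good (hb : b ∈ H.verts) (he : H.IsStrongBridge x y)
    (hin : ∀ v ∈ H.verts, H.GoodIn b O v) (hout : ∀ v ∈ H.verts, H.GoodOut b O v) :
    H.SplitsOff O x y :=
  splitsOff_of_base hb he (fun v hv => (hin v hv).reach_or x y)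
    fun v hv => (hout v hv).reach_or x y

/-! ### A vertex whose only in-neighbour is the base vertex -/

/-- As `splitsOff_of_good`, but nothing is assumed on the edges leaving the vertex `d`, which is
entered from the base vertex only. -/
theorem splitsOff_or_splitsOffWith (hH : H.IsStronglyConnected) (hr : r ∈ H.verts)
    (hd : d ∈ H.verts) (hdr : d ≠ r) (hdO : d ∉ O) (hself : ∀ v, ¬ H.Adj v v)
    (hdin : ∀ u, H.Adj u d → u = r) (he : H.IsStrongBridge x y)
    (hin : ∀ v ∈ H.verts, H.GoodIn r O v) (hout : ∀ v ∈ H.verts, v ≠ d → H.GoodOut r O v) :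
    H.SplitsOff O x y ∨ (x ∈ H.verts ∧ x ∉ O ∧ (∀ v, H.Adj d v ↔ v = x) ∧
      H.SplitsOffWith O d x y) := by
  have hin' := fun v hv => (hin v hv).reach_or x y
  have hout' := fun v hv hvd => (hout v hv hvd).reach_or x y
  have hx := he.1.left_mem
  have hy := he.1.right_mem
  by_cases hdr' : (H.deleteEdge x y).Reach d r
  · left
    refine splitsOff_of_base hr he hin' fun v hv => ?_
    by_cases hvd : v = d
    · subst hvd; exact .inl hdr'
    · exact hout' v hv hvd
  by_cases hxd : x = d
  · left
    refine splitsOff_of_base hr he hin' fun v hv => ?_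
    by_cases hvd : v = d
    · exact .inr ⟨hvd.trans hxd.symm, hxd ▸ hdO⟩
    · exact hout' v hv hvd
  right
  have hadj : ∀ v, H.Adj d v → (H.deleteEdge x y).Adj d v :=
    fun v h => h.deleteEdge fun h => absurd h.symm hxd
  -- An out-neighbour of `d` that reached `r` would let `d` reach `r`; the only vertex besides `d`
  -- that may fail to reach `r` is `x`.
  have hcase : ∀ v, H.Adj d v → v = x ∧ x ∉ O := by
    intro v hv
    have hvd : v ≠ d := by rintro rfl; exact hself _ hv
    exact (hout' v hv.right_mem hvd).resolve_left fun h => hdr' (.head (hadj v hv) h)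
  obtain ⟨v, hv⟩ : ∃ v, H.Adj d v := by
    rcases Relation.ReflTransGen.cases_head (hH.reach hd hr) with h | ⟨v, hv, -⟩
    · exact absurd h hdr
    · exact ⟨v, hv⟩
  have hdx : H.Adj d x := (hcase v hv).1 ▸ hv
  have hxO := (hcase v hv).2
  have hxr : ¬ (H.deleteEdge x y).Reach x r := fun h => hdr' (.head (hadj x hdx) h)
  have hrx : r ≠ x := by rintro rfl; exact hxr .refl
  have hyd : y ≠ d := by
    intro h
    exact hrx (hdin x (h ▸ he.1)).symm
  have hsx : ∀ v, (H.deleteEdge x y).StronglyConn v x → v = x := by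
    intro v
    refine eq_of_stronglyConn_of_not_adj_from fun w hw ha => hxr ?_
    have hwd : w ≠ d := by
      rintro rfl
      exact hrx (hdin x ha.of_deleteEdge).symm
    rcases hout' w ha.right_mem hwd with h | h
    · exact .head ha h
    · exact absurd h.1 hw
  -- A walk returning to `d` enters it from `r`, which `d` no longer reaches.
  have hsd : ∀ v, (H.deleteEdge x y).StronglyConn v d → v = d := by
    intro v hv
    by_contra hne
    obtain ⟨c, hc, hdc⟩ :
        ∃ c, (H.deleteEdge x y).Adj c d ∧ (H.deleteEdge x y).Reach v c := by
      rcases Relation.ReflTransGen.cases_tail hv.2.2.1 with h | ⟨c, h1, h2⟩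
      · exact absurd h.symm hne
      · exact ⟨c, h2, h1⟩
    rw [hdin c hc.of_deleteEdge] at hdc
    exact hdr' (hv.2.2.2.trans hdc)
  have hsc : ∀ v ∈ H.verts, v ≠ x → v ≠ d →
      (v = y → (H.deleteEdge x y).Reach r y) → (H.deleteEdge x y).StronglyConn v r := by
    intro v hv h1 h2 h3
    refine ⟨hv, hr, (hout' v hv h2).resolve_right fun h => h1 h.1, ?_⟩
    rcases hin' v hv with h | h
    · exact h
    · rw [h.1]; exact h3 h.1
  refine ⟨hx, hxO, fun v => ⟨fun h => (hcase v h).1, fun h => h ▸ hdx⟩, hxO, hdO, ?_⟩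
  by_cases hry : (H.deleteEdge x y).Reach r y
  · left
    exact sccs_eq_two hr hx hd hrx hdr.symm (fun v hv h1 h2 => hsc v hv h1 h2 fun _ => hry) hsx hsd
  · right
    refine ⟨((hin' y hy).resolve_left hry).2, ?_⟩
    have hsy : ∀ v, (H.deleteEdge x y).StronglyConn v y → v = y := by
      intro v
      refine eq_of_stronglyConn_of_not_adj_to fun w hw ha => hry ?_
      rcases hin' w ha.left_mem with h | h
      · exact .tail h ha
      · exact absurd h.1 hw
    refine sccs_eq_three hr hx hy hd hrx ?_ hdr.symm
      (fun v hv h1 h2 h3 => hsc v hv h1 h3 fun h => absurd h h2) hsx hsy hsd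
    rintro rfl
    exact hry .refl

/-! ### Bypassing that vertex -/

theorem bypass_mult (hu : u ∈ H.verts) (hv : v ∈ H.verts) (hud : u ≠ d) (hvd : v ≠ d) :
    (H.bypass d r x).mult u v = H.mult u v + if u = r ∧ v = x then 1 else 0 := by
  simp only [bypass, ofMult]
  rw [if_pos]
  simp [hu, hv, hud, hvd]

theorem Adj.bypass (h : H.Adj u v) (hud : u ≠ d) (hvd : v ≠ d) : (H.bypass d r x).Adj u v := by
  have := bypass_mult (r := r) (x := x) h.left_mem h.right_mem hud hvd
  unfold Adj at *
  omega

theorem deleteEdge_bypass_adj (h : (H.deleteEdge y z).Adj u v) (hud : u ≠ d) (hvd : v ≠ d) :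
    ((H.bypass d r x).deleteEdge y z).Adj u v := by
  rw [deleteEdge_adj] at h ⊢
  have := bypass_mult (r := r) (x := x) h.1.left_mem h.1.right_mem hud hvd
  refine ⟨h.1.bypass hud hvd, fun h1 h2 => ?_⟩
  have := h.2 h1 h2
  omega

theorem adj_of_bypass_adj (h : (H.bypass d r x).Adj u v) (hne : u = r → v ≠ x) : H.Adj u v := by
  have hu := h.left_mem
  have hv := h.right_mem
  have := bypass_mult (r := r) (x := x) hu.1 hv.1 hu.2 hv.2
  rw [if_neg fun h => hne h.1 h.2] at this
  unfold Adj at *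
  omega

theorem bypass_robustFrom (hr : r ∈ H.verts) (hx : x ∈ H.verts) (hdr : d ≠ r) (hxd : x ≠ d)
    (hdin : ∀ u, ¬ (H.deleteEdge r d).Adj u d) (hdout : ∀ v, H.Adj d v → v = x)
    (hvd : v ≠ d) (h : H.RobustFrom r v) : (H.bypass d r x).RobustFrom r v := by
  have hm := bypass_mult (r := r) (x := x) hr hx hdr.symm hxd
  rw [if_pos ⟨rfl, rfl⟩] at hm
  have ha : (H.bypass d r x).Adj r x := by unfold Adj; omega
  intro y z
  by_cases he : y = r ∧ z = x
  · obtain ⟨rfl, rfl⟩ := he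
    -- Deleting the new edge is simulated in `H` by deleting `(r, d)`: walks from `r` then avoid
    -- `d`. Any old edge from `r` to `x` survives, since the new one made its multiplicity at least
    -- two.
    have key : ∀ c, (H.deleteEdge y d).Reach y c →
        c ≠ d ∧ ((H.bypass d y z).deleteEdge y z).Reach y c := by
      intro c hc
      induction hc with
      | refl => exact ⟨hdr.symm, .refl⟩
      | @tail b c _ hbc ih =>
        have hcd : c ≠ d := by rintro rfl; exact hdin b hbc
        have hb := hbc.of_deleteEdge
        refine ⟨hcd, ih.2.tail (deleteEdge_adj.2 ⟨hb.bypass ih.1 hcd, ?_⟩)⟩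
        rintro rfl rfl
        unfold Adj at hb
        omega
    exact (key v (h y d)).2
  -- Here the new edge is intact, and a walk through `d` continues to `x`, which `r` now reaches
  -- directly.
  · have key : ∀ c, (H.deleteEdge y z).Reach r c →
        ((H.bypass d r x).deleteEdge y z).Reach r c ∨ c = d := by
      intro c hc
      induction hc with
      | refl => exact .inl .refl
      | @tail b c _ hbc ih =>
        by_cases hcd : c = d
        · exact .inr hcd
        left
        by_cases hbd : b = d
        · subst hbd
          rw [hdout c hbc.of_deleteEdge]
          exact .single (ha.deleteEdge fun h1 h2 => he ⟨h1.symm, h2.symm⟩)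
        · exact (ih.resolve_right hbd).tail (deleteEdge_bypass_adj hbc hbd hcd)
    exact (key v (h y z)).resolve_right hvd

/-- A walk towards `r` that enters `d` comes from `r`, so it can be stopped there. -/
theorem bypass_robustTo (hdin : ∀ u, H.Adj u d → u = r) (hvd : v ≠ d) (h : H.RobustTo r v) :
    (H.bypass d r x).RobustTo r v := by
  intro y z
  have key : ∀ c, (H.deleteEdge y z).Reach c r →
      ((H.bypass d r x).deleteEdge y z).Reach c r ∨ c = d := by
    intro c hc
    induction hc using Relation.ReflTransGen.head_induction_on with
    | refl => exact .inl .refl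
    | @head b c hbc _ ih =>
      by_cases hbd : b = d
      · exact .inr hbd
      left
      by_cases hcd : c = d
      · rw [hcd] at hbc
        rw [hdin b hbc.of_deleteEdge]; exact .refl
      · exact .head (deleteEdge_bypass_adj hbc hbd hcd) (ih.resolve_right hcd)
  exact (key v (h y z)).resolve_right hvd

theorem splitsOff_bypass (hr : r ∈ H.verts) (hdr : d ≠ r) (hself : ∀ v, ¬ H.Adj v v)
    (hdin : ∀ u, ¬ (H.deleteEdge r d).Adj u d) (hdout : ∀ v, H.Adj d v ↔ v = w)
    (hin : ∀ v ∈ H.verts, H.GoodIn r O v) (hout : ∀ v ∈ H.verts, v ≠ d → H.GoodOut r O v)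
    (he : (H.bypass d r w).IsStrongBridge x y) : (H.bypass d r w).SplitsOff O x y := by
  have hdw : H.Adj d w := (hdout w).2 rfl
  have hwd : w ≠ d := by rintro rfl; exact hself _ hdw
  have hdin' : ∀ u, H.Adj u d → u = r := fun u hu => by
    by_contra hne
    exact hdin u (hu.deleteEdge fun h => absurd h hne)
  have hfrom : ∀ v, v ≠ d → H.RobustFrom r v → (H.bypass d r w).RobustFrom r v :=
    fun v hv h => bypass_robustFrom hr hdw.right_mem hdr hwd hdin (fun v => (hdout v).1) hv h
  have hto : ∀ v, v ≠ d → H.RobustTo r v → (H.bypass d r w).RobustTo r v :=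
    fun v hv h => bypass_robustTo hdin' hv h
  -- So `d` is never the robust sole in-neighbour of a vertex. As `d` is an in-neighbour of `w`, the
  -- new edge into `w` spoils no uniqueness claim in `GoodIn`.
  have hdrob : ¬ H.RobustFrom r d := by
    intro h
    rcases Relation.ReflTransGen.cases_tail (h r d) with h | ⟨c, -, h⟩
    · exact hdr h
    · exact hdin c h
  refine splitsOff_of_good ⟨hr, hdr.symm⟩ he ?_ ?_
  · rintro v ⟨hv, hvd⟩
    rcases hin v hv with h | ⟨hO, c, hc, hcv, huniq⟩
    · exact .inl (hfrom v hvd h)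
    · have hcd : c ≠ d := by rintro rfl; exact hdrob hc
      have hvw : v ≠ w := by
        rintro rfl
        exact hcd (huniq d hdw).symm
      exact .inr ⟨hO, c, hfrom c hcd hc, hcv.bypass hcd hvd, fun u hu =>
        huniq u (adj_of_bypass_adj hu fun _ => hvw)⟩
  · rintro v ⟨hv, hvd⟩
    by_cases hvr : v = r
    · subst hvr
      exact .inl fun _ _ => .refl
    rcases hout v hv hvd with h | ⟨hO, c, hc, hvc⟩
    · exact .inl (hto v hvd h)
    · have hcd : c ≠ d := by
        rintro rfl
        exact hvr (hdin' v hvc)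
      exact .inr ⟨hO, c, hto c hcd hc, hvc.bypass hvd hcd⟩

end MultiDigraph

/-! ### The graphs produced by the `S`-operation. -/

namespace MultiDigraph

open scoped Classical

variable {V : Type*} {G H : MultiDigraph V} {O C : Set V} {a b c d r u v w x y z : V}

/-! ### Components -/

theorem mem_verts_of_mem_sccs (hC : C ∈ G.sccs) (hu : u ∈ C) : u ∈ G.verts := by
  obtain ⟨c, -, rfl⟩ := hC
  exact hu.1

theorem nonempty_of_mem_sccs (hC : C ∈ G.sccs) : C.Nonempty := by
  obtain ⟨c, hc, rfl⟩ := hC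
  exact ⟨c, .refl hc⟩

theorem stronglyConn_of_mem_sccs (hC : C ∈ G.sccs) (hu : u ∈ C) (hv : v ∈ C) :
    G.StronglyConn u v := by
  obtain ⟨c, -, rfl⟩ := hC
  exact StronglyConn.trans hu (StronglyConn.symm hv)

theorem mem_of_stronglyConn (hC : C ∈ G.sccs) (hv : v ∈ C) (h : G.StronglyConn u v) : u ∈ C := by
  obtain ⟨c, -, rfl⟩ := hC
  exact h.trans hv

/-- Every vertex on a walk between two vertices of a component belongs to the component. -/
theorem reach_within_of_mem_sccs (hC : C ∈ G.sccs) (hu : u ∈ C) (hv : v ∈ C) :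
    Relation.ReflTransGen (fun a b => G.Adj a b ∧ a ∈ C ∧ b ∈ C) u v := by
  have hGv := mem_verts_of_mem_sccs hC hu
  have key : ∀ c, G.Reach c v → G.Reach u c →
      Relation.ReflTransGen (fun a b => G.Adj a b ∧ a ∈ C ∧ b ∈ C) c v := by
    intro c hc
    have hvu := (stronglyConn_of_mem_sccs hC hv hu).2.2.1
    have hmem : ∀ e, G.Reach e v → G.Reach u e → e ∈ C := fun e he hue =>
      mem_of_stronglyConn hC hu ⟨hue.mem hGv, hGv, Relation.ReflTransGen.trans he hvu, hue⟩
    induction hc using Relation.ReflTransGen.head_induction_on with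
    | refl => exact fun _ => .refl
    | @head e f hef hf ih =>
      intro hue
      have huf : G.Reach u f := hue.tail hef
      exact .head ⟨hef, hmem e (.head hef hf) hue, hmem f hf huf⟩ (ih huf)
  exact key u (stronglyConn_of_mem_sccs hC hu hv).2.2.1 .refl

/-- In a graph with two vertices, at least one of which is not in `O`, every strong bridge separates
the two. -/
theorem splitsOff_of_verts_eq_pair (hV : H.verts = {a, b}) (hab : a ≠ b) (ha : a ∉ O)
    (he : H.IsStrongBridge x y) : H.SplitsOff O x y := by
  have hav : a ∈ H.verts := by simp [hV]
  have hbv : b ∈ H.verts := by simp [hV]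
  have hn : ¬ (H.deleteEdge x y).StronglyConn b a := by
    intro hba
    obtain ⟨-, u, v, huv, hn⟩ := he
    have hall : ∀ c ∈ H.verts, (H.deleteEdge x y).StronglyConn c a := by
      intro c hc
      rw [hV] at hc
      rcases hc with rfl | rfl
      · exact .refl hav
      · exact hba
    exact hn ((hall u huv.1).trans (hall v huv.2.1).symm)
  have hcases : ∀ c ∈ H.verts, c = a ∨ c = b := fun c hc => by rw [hV] at hc; exact hc
  have hs : (H.deleteEdge x y).sccs = {{a}, H.verts \ {a}} := by
    refine sccs_eq_one (b := b) hbv hav hab.symm (fun v hv hva => ?_) fun v hv => ?_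
    · rw [(hcases v hv).resolve_left hva]; exact .refl hbv
    · refine (hcases v hv.1).resolve_right ?_
      rintro rfl; exact hn hv
  rcases hcases x he.1.left_mem with rfl | hx
  · exact .inl ⟨ha, hs⟩
  rcases hcases y he.1.right_mem with rfl | hy
  · exact .inr (.inl ⟨ha, hs⟩)
  exact absurd (hx.trans hy.symm) he.ne

/-! ### The graphs produced by the `S`-operation -/

variable [Fintype V]

theorem sGraph_verts : (H.sGraph d r C).verts = C ∪ {d, r} := rfl

theorem sGraph_mult (hu : u ∈ C ∪ {d, r}) (hv : v ∈ C ∪ {d, r}) :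
    (H.sGraph d r C).mult u v =
      (if u ∈ C ∧ v ∈ C then H.mult u v else 0)
      + (if u ∈ C ∧ v = d then ∑ w : V, if w ∉ C then H.mult u w else 0 else 0)
      + (if u = r ∧ v ∈ C then ∑ w : V, if w ∉ C then H.mult w v else 0 else 0)
      + (if u = d ∧ v = r then 1 else 0) :=
  if_pos ⟨hu, hv⟩

theorem mult_le_sGraph_mult (hu : u ∈ C) (hv : v ∈ C) :
    H.mult u v ≤ (H.sGraph d r C).mult u v := by
  rw [sGraph_mult (.inl hu) (.inl hv), if_pos ⟨hu, hv⟩]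
  omega

theorem leaving_le_sGraph_mult (hu : u ∈ C) :
    (∑ w : V, if w ∉ C then H.mult u w else 0) ≤ (H.sGraph d r C).mult u d := by
  rw [sGraph_mult (.inl hu) (by simp), if_pos (c := u ∈ C ∧ d = d) ⟨hu, rfl⟩]
  omega

theorem entering_le_sGraph_mult (hv : v ∈ C) :
    (∑ w : V, if w ∉ C then H.mult w v else 0) ≤ (H.sGraph d r C).mult r v := by
  rw [sGraph_mult (by simp) (.inl hv), if_pos (c := r = r ∧ v ∈ C) ⟨rfl, hv⟩]
  omega

theorem mult_le_sGraph_mult_left (hu : u ∈ C) (hv : v ∉ C) :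
    H.mult u v ≤ (H.sGraph d r C).mult u d := by
  refine le_trans ?_ (leaving_le_sGraph_mult hu)
  refine le_trans (le_of_eq ?_) (Finset.single_le_sum (fun _ _ => Nat.zero_le _)
    (Finset.mem_univ v))
  rw [if_pos hv]

theorem mult_le_sGraph_mult_right (hu : u ∉ C) (hv : v ∈ C) :
    H.mult u v ≤ (H.sGraph d r C).mult r v := by
  refine le_trans ?_ (entering_le_sGraph_mult hv)
  refine le_trans (le_of_eq ?_) (Finset.single_le_sum (fun _ _ => Nat.zero_le _)
    (Finset.mem_univ u))
  rw [if_pos hu]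

theorem sGraph_adj_of_mem (h : H.Adj u v) (hu : u ∈ C) (hv : v ∈ C) :
    (H.sGraph d r C).Adj u v := lt_of_lt_of_le h (mult_le_sGraph_mult hu hv)

theorem sGraph_adj_left (h : H.Adj u v) (hu : u ∈ C) (hv : v ∉ C) :
    (H.sGraph d r C).Adj u d := lt_of_lt_of_le h (mult_le_sGraph_mult_left hu hv)

theorem sGraph_adj_right (h : H.Adj u v) (hu : u ∉ C) (hv : v ∈ C) :
    (H.sGraph d r C).Adj r v := lt_of_lt_of_le h (mult_le_sGraph_mult_right hu hv)

theorem sGraph_adj_crit : (H.sGraph d r C).Adj d r := by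
  unfold Adj
  rw [sGraph_mult (by simp) (by simp), if_pos (c := d = d ∧ r = r) ⟨rfl, rfl⟩]
  omega

theorem sGraph_adj_cases (h : (H.sGraph d r C).Adj u v) :
    (u ∈ C ∧ v ∈ C ∧ H.Adj u v) ∨ (u ∈ C ∧ v = d) ∨
    (u = r ∧ v ∈ C ∧ ∃ w, w ∉ C ∧ H.Adj w v) ∨ (u = d ∧ v = r) := by
  have hu := h.left_mem
  have hv := h.right_mem
  unfold Adj at h
  rw [sGraph_mult hu hv] at h
  by_contra! hc
  obtain ⟨h1, h2, h3, h4⟩ := hc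
  rw [if_neg (c := u ∈ C ∧ v = d) fun h => h2 h.1 h.2,
    if_neg (c := u = d ∧ v = r) fun h => h4 h.1 h.2] at h
  have e1 : (if u ∈ C ∧ v ∈ C then H.mult u v else 0) = 0 := by
    split_ifs with hc
    · have := h1 hc.1 hc.2
      unfold Adj at this
      omega
    · rfl
  have e2 : (if u = r ∧ v ∈ C then ∑ w : V, if w ∉ C then H.mult w v else 0 else 0) = 0 := by
    split_ifs with hc
    · refine Finset.sum_eq_zero fun w _ => ?_
      split_ifs with hw
      · rfl
      · have := h3 hc.1 hc.2 w hw
        unfold Adj at this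
        omega
    · rfl
  omega

theorem sGraph_deleteEdge_not_adj (hdC : d ∉ C) (hdr : d ≠ r) :
    ¬ ((H.sGraph d r C).deleteEdge d r).Adj d v := by
  intro h
  rcases sGraph_adj_cases h.of_deleteEdge with h' | h' | h' | h'
  · exact hdC h'.1
  · exact hdC h'.1
  · exact hdr h'.1
  · have h2 := (deleteEdge_adj.1 h).2 rfl h'.2
    rw [h'.2, sGraph_mult (by simp) (by simp)] at h2
    simp [hdC, hdr] at h2

/-- The deletion of an edge of the `S`-graph other than the critical edge is matched by the deletion
of an edge of `H`. -/
theorem sGraph_deleteEdge_lift (hdC : d ∉ C) (x y : V) : ∃ x' y', ∀ u v,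
    (u ∈ C ∨ v ∈ C) ∧ (u ∉ C → r ∉ C) → (H.deleteEdge x' y').Adj u v →
    ((H.sGraph d r C).deleteEdge x y).Adj (if u ∈ C then u else r) (if v ∈ C then v else d) := by
  -- Outside tails go to `r` and outside heads to `d`. When `r ∈ C`, entering edges are excluded, so
  -- the image determines whether each end lies in `C`; for heads `d ∉ C` suffices.
  refine exists_deleteEdge_lift (fun u v => (u ∈ C ∨ v ∈ C) ∧ (u ∉ C → r ∉ C))
    (fun u v => (if u ∈ C then u else r, if v ∈ C then v else d)) ?_ ?_ ?_ x y
  · intro u v hR h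
    by_cases hu : u ∈ C <;> by_cases hv : v ∈ C <;> simp only [hu, hv, if_true, if_false]
    · exact sGraph_adj_of_mem h hu hv
    · exact sGraph_adj_left h hu hv
    · exact sGraph_adj_right h hu hv
    · tauto
  · intro u v hR h
    by_cases hu : u ∈ C <;> by_cases hv : v ∈ C <;> simp only [hu, hv, if_true, if_false]
    · exact h.trans (mult_le_sGraph_mult hu hv)
    · exact h.trans (mult_le_sGraph_mult_left hu hv)
    · exact h.trans (mult_le_sGraph_mult_right hu hv)
    · tauto
  · intro u v u' v' hR hR' h h' he hne
    have he1 := congrArg Prod.fst he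
    have he2 := congrArg Prod.snd he
    simp only at he1 he2 ⊢
    have hu' : u ∈ C ↔ u' ∈ C := by
      by_cases hu : u ∈ C <;> by_cases hu' : u' ∈ C <;>
        simp only [hu, hu', if_true, if_false] at he1 ⊢
      · exact (hR'.2 hu' (he1 ▸ hu)).elim
      · exact (hR.2 hu (he1 ▸ hu')).elim
    have hv' : v ∈ C ↔ v' ∈ C := by
      by_cases hv : v ∈ C <;> by_cases hv' : v' ∈ C <;>
        simp only [hv, hv', if_true, if_false] at he2 ⊢
      · exact (hdC (he2 ▸ hv)).elim
      · exact (hdC (he2 ▸ hv')).elim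
    by_cases hu : u ∈ C <;> by_cases hv : v ∈ C <;>
      simp only [hu, hv, ← hu', ← hv', if_true, if_false] at he1 he2 ⊢
    · exact absurd (Prod.ext he1 he2) hne
    · subst he1
      refine le_trans (two_le_sum (Finset.mem_univ v) (Finset.mem_univ v')
        (fun h => hne (Prod.ext rfl h)) ?_ ?_) (leaving_le_sGraph_mult hu)
      · rw [if_pos hv]; exact h
      · rw [if_pos (fun h => hv (hv'.2 h))]; exact h'
    · subst he2
      refine le_trans (two_le_sum (Finset.mem_univ u) (Finset.mem_univ u')
        (fun h => hne (Prod.ext h rfl)) ?_ ?_) (entering_le_sGraph_mult hv)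
      · rw [if_pos hu]; exact h
      · rw [if_pos (fun h => hu (hu'.2 h))]; exact h'
    · tauto

/-- Only the last stretch of a walk inside `C` matters: an entry into `C` from outside becomes an
edge from `r`, or, when `r ∈ C`, happens at `r` itself. -/
theorem sGraph_robustFrom (hdC : d ∉ C)
    (hent : r ∈ C → ∀ u v, u ∉ C → v ∈ C → H.Adj u v → v = r)
    (hv : v ∈ C) (h : H.RobustFrom r v) : (H.sGraph d r C).RobustFrom r v := by
  intro x y
  obtain ⟨x', y', hl⟩ := sGraph_deleteEdge_lift (H := H) (r := r) hdC x y
  have key : ∀ c, (H.deleteEdge x' y').Reach r c → c ∈ C →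
      ((H.sGraph d r C).deleteEdge x y).Reach r c := by
    intro c hc
    induction hc with
    | refl => exact fun _ => .refl
    | @tail b c _ hbc ih =>
      intro hcC
      by_cases hcr : c = r
      · rw [hcr]; exact .refl
      by_cases hbC : b ∈ C
      · have := hl b c ⟨.inl hbC, fun h => absurd hbC h⟩ hbc
        rw [if_pos hbC, if_pos hcC] at this
        exact (ih hbC).tail this
      · have := hl b c ⟨.inr hcC, fun _ hrC => hcr (hent hrC b c hbC hcC hbc.of_deleteEdge)⟩ hbc
        rw [if_neg hbC, if_pos hcC] at this
        exact .single this
  exact key v (h x' y') hv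

/-- The walk is followed until it first leaves `C`; the leaving edge becomes an edge to `d`. -/
theorem sGraph_robustTo (hdC : d ∉ C) (hv : v ∈ C) (h : H.RobustTo d v) :
    (H.sGraph d r C).RobustTo d v := by
  intro x y
  obtain ⟨x', y', hl⟩ := sGraph_deleteEdge_lift (H := H) (r := r) hdC x y
  have key : ∀ c, (H.deleteEdge x' y').Reach c d → c ∈ C →
      ((H.sGraph d r C).deleteEdge x y).Reach c d := by
    intro c hc
    induction hc using Relation.ReflTransGen.head_induction_on with
    | refl => exact fun _ => .refl
    | @head b c hbc _ ih =>
      intro hbC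
      have := hl b c ⟨.inl hbC, fun h => absurd hbC h⟩ hbc
      rw [if_pos hbC] at this
      by_cases hcC : c ∈ C
      · rw [if_pos hcC] at this
        exact .head this (ih hcC)
      · rw [if_neg hcC] at this
        exact .single this
  exact key v (h x' y') hv

theorem sGraph_reach_from (hdC : d ∉ C)
    (hent : r ∈ C → ∀ u v, u ∉ C → v ∈ C → H.Adj u v → v = r)
    (hv : v ∈ C) (h : H.GoodIn r O v) (x y : V) :
    ((H.sGraph d r C).deleteEdge x y).Reach r v ∨ (v = y ∧ y ∉ C ∩ O) := by
  rcases h with h | ⟨hO, w, hw, ha, -⟩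
  · exact .inl (sGraph_robustFrom hdC hent hv h x y)
  have hex : ∃ w', (H.sGraph d r C).RobustFrom r w' ∧ (H.sGraph d r C).Adj w' v := by
    by_cases hwC : w ∈ C
    · exact ⟨w, sGraph_robustFrom hdC hent hwC hw, sGraph_adj_of_mem ha hwC hv⟩
    · exact ⟨r, fun _ _ => .refl, sGraph_adj_right ha hwC hv⟩
  obtain ⟨w', hw', ha'⟩ := hex
  by_cases he : w' = x ∧ v = y
  · exact .inr ⟨he.2, fun h => hO (he.2 ▸ h.2)⟩
  · exact .inl ((hw' x y).tail (ha'.deleteEdge fun h1 h2 => he ⟨h1, h2⟩))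

theorem sGraph_reach_to (hdC : d ∉ C) (hv : v ∈ C) (h : H.GoodOut d O v) (x y : V) :
    ((H.sGraph d r C).deleteEdge x y).Reach v d ∨ (v = x ∧ x ∉ C ∩ O) := by
  rcases h with h | ⟨hO, w, hw, ha⟩
  · exact .inl (sGraph_robustTo hdC hv h x y)
  have hex : ∃ w', (H.sGraph d r C).RobustTo d w' ∧ (H.sGraph d r C).Adj v w' := by
    by_cases hwC : w ∈ C
    · exact ⟨w, sGraph_robustTo hdC hwC hw, sGraph_adj_of_mem ha hv hwC⟩
    · exact ⟨d, fun _ _ => .refl, sGraph_adj_left ha hv hwC⟩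
  obtain ⟨w', hw', ha'⟩ := hex
  by_cases he : v = x ∧ w' = y
  · exact .inr ⟨he.1, fun h => hO (he.1 ▸ h.2)⟩
  · exact .inl (.head (ha'.deleteEdge fun h1 h2 => he ⟨h1, h2⟩) (hw' x y))

theorem sGraph_deleteEdge_reach (hC : C ∈ (H.deleteEdge d r).sccs) (hu : u ∈ C) (hv : v ∈ C) :
    ((H.sGraph d r C).deleteEdge d r).Reach u v := by
  refine reflTransGen_imp (fun a b hab => ?_) (reach_within_of_mem_sccs hC hu hv)
  have h1 := deleteEdge_adj.1 hab.1
  refine deleteEdge_adj.2 ⟨sGraph_adj_of_mem h1.1 hab.2.1 hab.2.2, fun ha hb => ?_⟩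
  exact (h1.2 ha hb).trans (mult_le_sGraph_mult hab.2.1 hab.2.2)

/-! #### The component of the head of the critical edge -/

theorem splitsOff_sGraph_of_mem (hH : H.IsStronglyConnected) (hdr : H.Adj d r) (hne : d ≠ r)
    (hd : ∀ v, ¬ (H.deleteEdge d r).Adj d v)
    (hin : ∀ v ∈ H.verts, v ≠ d → H.GoodIn r O v)
    (hout : ∀ v ∈ H.verts, v ≠ d → H.GoodOut d O v)
    (hC : C ∈ (H.deleteEdge d r).sccs) (hdC : d ∉ C) (hrC : r ∈ C)
    (he : (H.sGraph d r C).IsStrongBridge x y) :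
    (H.sGraph d r C).SplitsOff (C ∩ O) x y := by
  have hCv : ∀ v ∈ C, v ∈ H.verts := fun v hv =>
    mem_verts_of_mem_sccs (G := H.deleteEdge d r) hC hv
  have hCd : ∀ v ∈ C, v ≠ d := by rintro v hv rfl; exact hdC hv
  have hcases : ∀ v ∈ (H.sGraph d r C).verts, v ∈ C ∨ v = d := by
    rintro v (hv | rfl | rfl)
    · exact .inl hv
    · exact .inr rfl
    · exact .inl hrC
  by_cases hcrit : x = d ∧ y = r
  · obtain ⟨rfl, rfl⟩ := hcrit
    refine splitsOff_of_base (b := y) (.inl hrC) he (fun v hv => .inl ?_) fun v hv => ?_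
    · rcases hcases v hv with hv | rfl
      · exact sGraph_deleteEdge_reach hC hrC hv
      -- A walk of `H` from the head of the critical edge to its tail must leave `C`, and the first
      -- leaving edge becomes an edge to the tail.
      · have key : ∀ c, H.Reach y c → c ∈ C ∨ ((H.sGraph v y C).deleteEdge v y).Reach y v := by
          intro c hc
          induction hc with
          | refl => exact .inl hrC
          | @tail b c _ hbc ih =>
            rcases ih with ih | ih
            · by_cases hcC : c ∈ C
              · exact .inl hcC
              · right
                exact (sGraph_deleteEdge_reach hC hrC ih).tail
                  ((sGraph_adj_left hbc ih hcC).deleteEdge fun h => absurd h (hCd b ih))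
            · exact .inr ih
        exact (key v (hH.reach hdr.right_mem hdr.left_mem)).resolve_left hdC
    · rcases hcases v hv with hv | rfl
      · exact .inl (sGraph_deleteEdge_reach hC hv hrC)
      · exact .inr ⟨rfl, fun h => hdC h.1⟩
  -- An outside vertex `u ≠ d` is still reached from `r` without the critical edge, so an edge from
  -- `u` into `C` surviving that deletion would put `u` into the component.
  · have hent : r ∈ C → ∀ u v, u ∉ C → v ∈ C → H.Adj u v → v = r := by
      intro _ u v hu hv huv
      by_contra hvr
      have hua : (H.deleteEdge d r).Adj u v := huv.deleteEdge fun _ => hvr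
      have hud : u ≠ d := by rintro rfl; exact hd v hua
      have hru : (H.deleteEdge d r).Reach r u := by
        rcases hin u huv.left_mem hud with h | ⟨-, w, hw, hwu, -⟩
        · exact h d r
        · refine (hw d r).tail (hwu.deleteEdge fun _ => ?_)
          rintro rfl; exact hu hrC
      refine hu (mem_of_stronglyConn hC hrC ⟨huv.left_mem, hdr.right_mem, ?_, hru⟩)
      exact .head hua (stronglyConn_of_mem_sccs hC hv hrC).2.2.1
    have hdr' : ((H.sGraph d r C).deleteEdge x y).Adj d r :=
      sGraph_adj_crit.deleteEdge fun h1 h2 => hcrit ⟨h1.symm, h2.symm⟩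
    refine splitsOff_of_base (b := d) (.inr (.inl rfl)) he (fun v hv => ?_) fun v hv => ?_
    · rcases hcases v hv with hv | rfl
      · exact (sGraph_reach_from hdC hent hv (hin v (hCv v hv) (hCd v hv)) x y).imp_left
          fun h => .head hdr' h
      · exact .inl .refl
    · rcases hcases v hv with hv | rfl
      · exact sGraph_reach_to hdC hv (hout v (hCv v hv) (hCd v hv)) x y
      · exact .inl .refl

/-! #### The other components -/

/-- Without the critical edge, `d` is a sink, `r` is a source, and `C` remains strongly connected.
-/
theorem splitsOff_sGraph_crit (hne : d ≠ r) (hC : C ∈ (H.deleteEdge d r).sccs) (hdC : d ∉ C)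
    (hrC : r ∉ C) : (H.sGraph d r C).SplitsOff (C ∩ O) d r := by
  obtain ⟨c, hc⟩ := nonempty_of_mem_sccs hC
  have hnd := fun v => sGraph_deleteEdge_not_adj (H := H) (v := v) hdC hne
  refine .inr (.inr ⟨fun h => hdC h.1, fun h => hrC h.1, sccs_eq_two (b := c) (.inl hc)
    (.inr (.inl rfl)) (.inr (.inr rfl)) ?_ ?_ ?_ ?_ ?_⟩)
  · rintro rfl; exact hdC hc
  · rintro rfl; exact hrC hc
  · rintro w (hw | rfl | rfl) h1 h2
    · exact ⟨.inl hw, .inl hc, sGraph_deleteEdge_reach hC hw hc, sGraph_deleteEdge_reach hC hc hw⟩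
    · exact absurd rfl h1
    · exact absurd rfl h2
  · exact fun w => eq_of_stronglyConn_of_not_adj_from fun v _ => hnd v
  · refine fun w => eq_of_stronglyConn_of_not_adj_to fun v _ ha => ?_
    rcases sGraph_adj_cases ha.of_deleteEdge with h | h | h | h
    · exact hrC h.2.1
    · exact hne h.2.symm
    · exact hrC h.2.1
    · exact hnd r (h.1 ▸ ha)

theorem splitsOff_or_four_sGraph_of_not_mem (hne : d ≠ r)
    (hin : ∀ v ∈ H.verts, v ≠ d → H.GoodIn r O v)
    (hout : ∀ v ∈ H.verts, v ≠ d → v ≠ r → H.GoodOut d O v)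
    (hC : C ∈ (H.deleteEdge d r).sccs) (hdC : d ∉ C) (hrC : r ∉ C)
    (he : (H.sGraph d r C).IsStrongBridge x y) :
    (H.sGraph d r C).SplitsOff (C ∩ O) x y ∨
      (H.sGraph d r C).FourSingletons (C ∩ O) C d r x y := by
  by_cases hcrit : x = d ∧ y = r
  · rw [hcrit.1, hcrit.2]
    exact .inl (splitsOff_sGraph_crit hne hC hdC hrC)
  have hCv : ∀ v ∈ C, v ∈ H.verts := fun v hv =>
    mem_verts_of_mem_sccs (G := H.deleteEdge d r) hC hv
  have hCd : ∀ v ∈ C, v ≠ d := by rintro v hv rfl; exact hdC hv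
  have hCr : ∀ v ∈ C, v ≠ r := by rintro v hv rfl; exact hrC hv
  have hent : r ∈ C → ∀ u v, u ∉ C → v ∈ C → H.Adj u v → v = r := fun h => absurd h hrC
  have hdr' : ((H.sGraph d r C).deleteEdge x y).Adj d r :=
    sGraph_adj_crit.deleteEdge fun h1 h2 => hcrit ⟨h1.symm, h2.symm⟩
  have hfrom := fun v hv => sGraph_reach_from hdC hent hv (hin v (hCv v hv) (hCd v hv)) x y
  have hto := fun v hv => sGraph_reach_to (r := r) hdC hv
    (hout v (hCv v hv) (hCd v hv) (hCr v hv)) x y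
  -- If `r` still reaches `d`, the surviving critical edge makes `d` a base vertex in both
  -- directions.
  by_cases hN : ((H.sGraph d r C).deleteEdge x y).Reach r d
  · left
    refine splitsOff_of_base (b := d) (.inr (.inl rfl)) he ?_ ?_
    · rintro v (hv | rfl | rfl)
      · exact (hfrom v hv).imp_left fun h => .head hdr' h
      · exact .inl .refl
      · exact .inl (.single hdr')
    · rintro v (hv | rfl | rfl)
      · exact hto v hv
      · exact .inl .refl
      · exact .inl hN
  -- `d` and `r` are components by themselves
  have hSd : ∀ v, ((H.sGraph d r C).deleteEdge x y).Reach d v →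
      v = d ∨ ((H.sGraph d r C).deleteEdge x y).Reach r v := by
    intro v hv
    induction hv with
    | refl => exact .inl rfl
    | @tail b c _ hbc ih =>
      right
      rcases ih with rfl | ih
      · rcases sGraph_adj_cases hbc.of_deleteEdge with h | h | h | h
        · exact absurd h.1 hdC
        · exact absurd h.1 hdC
        · exact absurd h.1 hne
        · rw [h.2]; exact .refl
      · exact ih.tail hbc
  have hSr : ∀ v, ((H.sGraph d r C).deleteEdge x y).Reach v r →
      v = r ∨ ((H.sGraph d r C).deleteEdge x y).Reach v d := by
    intro v hv
    induction hv using Relation.ReflTransGen.head_induction_on with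
    | refl => exact .inl rfl
    | @head b c hbc _ ih =>
      right
      rcases ih with rfl | ih
      · rcases sGraph_adj_cases hbc.of_deleteEdge with h | h | h | h
        · exact absurd h.2.1 hrC
        · exact absurd h.2.symm hne
        · exact absurd h.2.1 hrC
        · rw [h.1]; exact .refl
      · exact .head hbc ih
  have hsd : ∀ v, ((H.sGraph d r C).deleteEdge x y).StronglyConn v d → v = d := by
    intro v hv
    rcases hSd v hv.2.2.2 with h | h
    · exact h
    · exact absurd (Relation.ReflTransGen.trans h hv.2.2.1) hN
  have hsr : ∀ v, ((H.sGraph d r C).deleteEdge x y).StronglyConn v r → v = r := by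
    intro v hv
    rcases hSr v hv.2.2.1 with h | h
    · exact h
    · exact absurd (Relation.ReflTransGen.trans hv.2.2.2 h) hN
  -- A robustly reached vertex that also reached `d` would join `r` to `d`; the only vertex of `C`
  -- that may fail to reach `d` is `x`.
  have hrobust : ∀ v ∈ C, H.RobustFrom r v → v = x ∧ x ∉ C ∩ O := by
    intro v hv h
    have h1 := sGraph_robustFrom hdC hent hv h x y
    exact (hto v hv).resolve_left fun h2 => hN (Relation.ReflTransGen.trans h1 h2)
  have hOC : ∀ v ∈ C, v ∉ O := by
    intro v hv
    rcases hin v (hCv v hv) (hCd v hv) with h | h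
    · obtain ⟨rfl, hx⟩ := hrobust v hv h
      exact fun hO => hx ⟨hv, hO⟩
    · exact h.1
  by_cases hone : ∃ c, C = {c}
  · left
    obtain ⟨c, rfl⟩ := hone
    have hcd : c ≠ d := hCd c rfl
    have hcr : c ≠ r := hCr c rfl
    have hO : ∀ v, v ∉ ({c} : Set V) ∩ O := fun v hv => hOC v hv.1 hv.2
    have hsc : ∀ v, ((H.sGraph d r {c}).deleteEdge x y).StronglyConn v c → v = c := by
      intro v hv
      rcases hv.1 with h | rfl | rfl
      · exact h
      · exact absurd (hsd c hv.symm) hcd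
      · exact absurd (hsr c hv.symm) hcr
    have hcm : c ∈ (H.sGraph d r {c}).verts := .inl rfl
    have hdm : d ∈ (H.sGraph d r {c}).verts := .inr (.inl rfl)
    have hrm : r ∈ (H.sGraph d r {c}).verts := .inr (.inr rfl)
    -- With `C = {c}` there are three vertices, each now a component, so the one not on the deleted
    -- edge is "the rest".
    have hxy : (x = c ∧ y = d) ∨ (x = r ∧ y = c) := by
      rcases sGraph_adj_cases he.1 with h | h | h | h
      · exact absurd (h.1.trans h.2.1.symm) he.ne
      · exact .inl h
      · exact .inr ⟨h.1, h.2.1⟩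
      · exact absurd h hcrit
    refine .inr (.inr ⟨hO x, hO y, ?_⟩)
    rcases hxy with ⟨rfl, rfl⟩ | ⟨rfl, rfl⟩
    · refine sccs_eq_two hrm hcm hdm hcr.symm hne.symm ?_ hsc hsd
      rintro w (rfl | rfl | rfl) h1 h2
      · exact absurd rfl h1
      · exact absurd rfl h2
      · exact .refl hrm
    · refine sccs_eq_two hdm hrm hcm hne hcd.symm ?_ hsr hsc
      rintro w (rfl | rfl | rfl) h1 h2
      · exact absurd rfl h2
      · exact .refl hdm
      · exact absurd rfl h1
  right
  -- a vertex of `C` that is not robustly reached has its only in-neighbour in `C`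
  have hpred : ∀ v ∈ C, ∀ w, (∀ u, H.Adj u v → u = w) → w ∈ C := by
    intro v hv w hw
    obtain ⟨c, hc, hcv⟩ : ∃ c ∈ C, c ≠ v := by
      by_contra! hcon
      exact hone ⟨v, Set.ext fun c => ⟨hcon c, fun h => h ▸ hv⟩⟩
    rcases Relation.ReflTransGen.cases_tail (reach_within_of_mem_sccs hC hc hv) with h | ⟨b, -, h⟩
    · exact absurd h.symm hcv
    · exact hw b h.1.of_deleteEdge ▸ h.2.1
  -- Any vertex of `C`, or else its sole in-neighbour, is robustly reached, and such a vertex of `C`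
  -- can only be `x`.
  have hxC : x ∈ C ∧ H.RobustFrom r x := by
    obtain ⟨c, hc⟩ := nonempty_of_mem_sccs hC
    have : ∃ t ∈ C, H.RobustFrom r t := by
      rcases hin c (hCv c hc) (hCd c hc) with h | ⟨-, w, hw, -, huniq⟩
      · exact ⟨c, hc, h⟩
      · exact ⟨w, hpred c hc w huniq, hw⟩
    obtain ⟨t, ht, htr⟩ := this
    have := (hrobust t ht htr).1
    subst this
    exact ⟨ht, htr⟩
  have hxd : ¬ ((H.sGraph d r C).deleteEdge x y).Reach x d := fun h =>
    hN (Relation.ReflTransGen.trans (sGraph_robustFrom hdC hent hxC.1 hxC.2 x y) h)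
  -- Such a `v` is entered only from `x` and still reaches `d`. Since `x` does not reach `d`, the
  -- edge from `x` to `v` must be the deleted one.
  have hother : ∀ v ∈ C, v ≠ x → v = y ∧ ∀ u, H.Adj u v → u = x := by
    intro v hv hvx
    rcases hin v (hCv v hv) (hCd v hv) with h | ⟨-, w, hw, hwv, huniq⟩
    · exact absurd (hrobust v hv h).1 hvx
    · have hwC := hpred v hv w huniq
      obtain rfl := (hrobust w hwC hw).1
      refine ⟨?_, huniq⟩
      by_contra hvy
      exact hxd (.head ((sGraph_adj_of_mem hwv hwC hv).deleteEdge fun _ => hvy)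
        ((hto v hv).resolve_right fun h => hvx h.1))
  have hyC : y ∈ C := by
    by_contra hyC
    refine hone ⟨x, Set.ext fun c => ⟨fun hc => ?_, fun h => h ▸ hxC.1⟩⟩
    by_contra hcx
    exact hyC ((hother c hc hcx).1 ▸ hc)
  have hCeq : C = {x, y} := by
    ext c
    constructor
    · intro hc
      by_cases hcx : c = x
      · exact .inl hcx
      · exact .inr (hother c hc hcx).1
    · rintro (rfl | rfl)
      · exact hxC.1
      · exact hyC
  have hxy := he.ne
  have hsx : ∀ v, ((H.sGraph d r C).deleteEdge x y).StronglyConn v x → v = x := by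
    refine fun v => eq_of_stronglyConn_of_not_adj_from fun w hw ha => hxd ?_
    rcases ha.right_mem with h | rfl | rfl
    · exact .head ha ((hto w h).resolve_right fun h => hw h.1)
    · exact .single ha
    · exfalso
      rcases sGraph_adj_cases ha.of_deleteEdge with h | h | h | h
      · exact hrC h.2.1
      · exact hne h.2.symm
      · exact hrC h.2.1
      · exact hCd x hxC.1 h.1
  have hxm : x ∈ (H.sGraph d r C).verts := .inl hxC.1
  have hym : y ∈ (H.sGraph d r C).verts := .inl hyC
  have hdm : d ∈ (H.sGraph d r C).verts := .inr (.inl rfl)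
  have hrm : r ∈ (H.sGraph d r C).verts := .inr (.inr rfl)
  have hverts : (H.sGraph d r C).verts = {x, y, d, r} := by
    rw [sGraph_verts, hCeq]
    ext c
    simp only [Set.mem_union, Set.mem_insert_iff, Set.mem_singleton_iff, or_assoc]
  have hxd' := hCd x hxC.1
  have hxr' := hCr x hxC.1
  have hyd' := hCd y hyC
  have hyr' := hCr y hyC
  refine ⟨hCeq, hverts, ?_, fun h => hOC x hxC.1 h.2, fun h => hOC y hyC h.2, ?_⟩
  · rw [hverts, Set.ncard_eq_toFinset_card']
    simp [hxy, hxd', hxr', hyd', hyr', hne]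
  -- Taking `y` as base vertex makes the remaining component `{y}`.
  · have h3 := sccs_eq_three (G := (H.sGraph d r C).deleteEdge x y) (b := y) hym hxm hdm hrm hxy.symm hyd' hyr' (fun c hc h1 h2 h3 => by
      rcases hc with hc | rfl | rfl
      · rw [(hother c hc h1).1]; exact .refl hym
      · exact absurd rfl h2
      · exact absurd rfl h3) hsx hsd hsr
    have hdiff : (H.sGraph d r C).verts \ {x, d, r} = {y} := by
      rw [hverts]
      ext c
      simp only [Set.mem_sdiff, Set.mem_insert_iff, Set.mem_singleton_iff]
      constructor
      · tauto
      · rintro rfl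
        exact ⟨.inr (.inl rfl), by tauto⟩
    rw [h3, deleteEdge_verts, hdiff, Set.pair_comm ({r} : Set V) {y},
      Set.insert_comm ({d} : Set V) {y}]

/-- The strong bridges of the graphs produced by the `S`-operation. -/
theorem splitsOff_or_four_sGraph (hH : H.IsStronglyConnected) (hdr : H.Adj d r) (hne : d ≠ r)
    (hd : ∀ v, ¬ (H.deleteEdge d r).Adj d v)
    (hin : ∀ v ∈ H.verts, v ≠ d → H.GoodIn r O v)
    (hout : ∀ v ∈ H.verts, v ≠ d → v ≠ r → H.GoodOut d O v)
    (hr : H.GoodOut d O r ∨ ∀ u, H.Adj u r → u = d)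
    (hC : C ∈ (H.deleteEdge d r).sccs) (he : (H.sGraph d r C).IsStrongBridge x y) :
    (H.sGraph d r C).SplitsOff (C ∩ O) x y ∨
      (H.sGraph d r C).FourSingletons (C ∩ O) C d r x y := by
  by_cases hdC : d ∈ C
  · left
    have hCeq : C = {d} := by
      ext c
      refine ⟨fun hc => ?_, fun h => h ▸ hdC⟩
      exact eq_of_stronglyConn_of_not_adj_from (fun w _ => hd w)
        (stronglyConn_of_mem_sccs hC hc hdC)
    refine splitsOff_of_verts_eq_pair (a := r) (b := d) ?_ hne.symm ?_ he
    · rw [sGraph_verts, hCeq]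
      ext c
      simp only [Set.mem_union, Set.mem_insert_iff, Set.mem_singleton_iff]
      tauto
    · rw [hCeq]
      exact fun h => hne h.1.symm
  by_cases hrC : r ∈ C
  · left
    rcases hr with hr | hr
    · refine splitsOff_sGraph_of_mem hH hdr hne hd hin (fun v hv hvd => ?_) hC hdC hrC he
      by_cases hvr : v = r
      · rw [hvr]; exact hr
      · exact hout v hv hvd hvr
    -- All edges into `r` come from `d`, which has no outgoing edge once the critical edge is
    -- deleted.
    · have hCeq : C = {r} := by
        ext c
        refine ⟨fun hc => ?_, fun h => h ▸ hrC⟩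
        refine eq_of_stronglyConn_of_not_adj_to (fun w _ ha => hd r ?_)
          (stronglyConn_of_mem_sccs hC hc hrC)
        have := hr w ha.of_deleteEdge
        rwa [this] at ha
      refine splitsOff_of_verts_eq_pair (a := d) (b := r) ?_ hne ?_ he
      · rw [sGraph_verts, hCeq]
        ext c
        simp only [Set.mem_union, Set.mem_insert_iff, Set.mem_singleton_iff]
        tauto
      · exact fun h => hdC h.1
  · exact splitsOff_or_four_sGraph_of_not_mem hne hin hout hC hdC hrC he

end MultiDigraph

/-! ### Application to `H_{rr'}` and the graphs derived from it. -/

namespace MultiDigraph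

open scoped Classical

variable {V : Type*} [Fintype V] {G L : MultiDigraph V} {C O S : Set V} {s r r' t u v w x y z : V}

/-! ### Vertices of an auxiliary graph -/

theorem aux_goodIn (hG : G.IsStronglyConnected) (hs : s ∈ G.verts) (hr : G.IsRoot s r)
    (hO : O ⊆ G.tree s r) (hv : v ∈ (G.aux s r).verts) (hd : r ≠ s → v ≠ G.idom s r) :
    (G.aux s r).GoodIn r O v := by
  rcases aux_verts_cases hG hs hv with h | h | h
  · exact .inl (aux_robustFrom hG hs hr h)
  · refine .inr ⟨fun hvO => ?_, G.idom s v, aux_robustFrom hG hs hr h.2,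
      (h.adj_iff hr hG hs).2 rfl, fun u => (h.adj_iff hr hG hs).1⟩
    exact h.not_mem_tree hG hs (mem_domSubtree_self (h.mem_verts hG hs)) (hO hvO)
  · exact absurd h.2 (hd h.1)

theorem aux_robustTo (h : G.RobustTo t v) (s r : V) :
    (G.aux s r).RobustTo (G.shrink s r t) (G.shrink s r v) := by
  intro x y
  obtain ⟨x', y', hl⟩ := aux_deleteEdge_lift (G := G) s r x y
  exact hl v t (h x' y')

/-- In an auxiliary graph of `L`, a vertex robustly reaches the image of `t`, or has an
out-neighbour that does, if each vertex of `L` shrunk into it is in a set `S` of vertices robustly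
reaching `t`, or has an out-neighbour in `S`. -/
theorem aux_goodOut (hS : ∀ u ∈ S, L.RobustTo t u)
    (hO : O ⊆ L.tree s r ∩ S) (hv : v ∈ (L.aux s r).verts)
    (hpre : ∀ u ∈ L.verts, L.shrink s r u = v → u ∈ S ∨ ∃ w ∈ S, L.Adj u w) :
    (L.aux s r).GoodOut (L.shrink s r t) O v := by
  by_cases hT : ∃ u ∈ S, L.shrink s r u = v
  · obtain ⟨u, hu, rfl⟩ := hT
    exact .inl (aux_robustTo (hS u hu) s r)
  · obtain ⟨u, hu, rfl⟩ := hv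
    rcases hpre u hu rfl with h | ⟨w, hw, ha⟩
    · exact absurd ⟨u, h, rfl⟩ hT
    · refine .inr ⟨fun hO' => hT ⟨_, (hO hO').2, shrink_of_mem_tree (hO hO').1⟩, _,
        aux_robustTo (hS w hw) s r, aux_adj_of_adj ha fun he => hT ⟨w, hw, he.symm⟩⟩

/-! ### The reverse of an auxiliary graph -/

theorem reverse_aux_robustTo (hG : G.IsStronglyConnected) (hs : s ∈ G.verts) (hr : G.IsRoot s r)
    (hv : v ∈ G.tree s r) : (G.aux s r).reverse.RobustTo r v := by
  intro x y
  exact reverse_deleteEdge_reach.2 (aux_robustFrom hG hs hr hv y x)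

/-- Reversal turns the sole edge entering a shrunken vertex into an edge leading from it into the
tree. -/
theorem reverse_aux_cases (hG : G.IsStronglyConnected) (hs : s ∈ G.verts) (hr : G.IsRoot s r)
    (hv : v ∈ (G.aux s r).reverse.verts) (hd : r ≠ s → v ≠ G.idom s r) :
    v ∈ G.tree s r ∨ ∃ w ∈ G.tree s r, (G.aux s r).reverse.Adj v w := by
  rcases aux_verts_cases hG hs hv with h | h | h
  · exact .inl h
  · exact .inr ⟨G.idom s v, h.2, (h.adj_iff hr hG hs).2 rfl⟩
  · exact absurd h.2 (hd h.1)

/-- In the reverse of `H(G_s, r)`, the edge `(r, d(r))` is a bridge. -/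
theorem reverse_aux_isBridge (hG : G.IsStronglyConnected) (hs : s ∈ G.verts) (hr : G.IsRoot s r)
    (hne : r ≠ s) : (G.aux s r).reverse.IsBridge r r (G.idom s r) := by
  have hadj := aux_idom_adj_iff (v := r) hr hG hs hne
  refine ⟨hadj.2 rfl, fun h => ?_⟩
  rcases Relation.ReflTransGen.cases_tail h with h | ⟨c, -, h⟩
  · refine idom_not_mem_tree hr hG hs hne ?_
    rw [h]
    exact mem_tree_self hG hs (hr.mem_verts hs)
  · rw [reverse_deleteEdge_adj, deleteEdge_adj] at h
    have hc := (aux_idom_adj_iff hr hG hs hne).1 h.1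
    have := h.2 rfl hc
    rw [hc] at this
    have := aux_idom_mult_le_one hr hG hs hne
    omega

/-- Makes the results on shrunken vertices available for `d(r)` as a vertex of `H_{rr}`, with `r` as
its only in-neighbour. -/
theorem isShrunk_idom (hG : G.IsStronglyConnected) (hs : s ∈ G.verts) (hr : G.IsRoot s r)
    (hne : r ≠ s) : (G.aux s r).reverse.IsShrunk r r (G.idom s r) ∧
      (G.aux s r).reverse.idom r (G.idom s r) = r := by
  have hL := (aux_isStronglyConnected (s := s) (r := r) hG).reverse
  have hrL : r ∈ (G.aux s r).reverse.verts := root_mem_aux hG hs hr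
  have hb := reverse_aux_isBridge hG hs hr hne
  have hi := hb.idom_eq hL hrL
  exact ⟨⟨⟨r, hb⟩, by rw [hi]; exact mem_tree_self hL hrL hrL⟩, hi⟩

/-! ### The graphs `H_{rr}` -/

theorem aux₂_isStronglyConnected (hG : G.IsStronglyConnected) :
    (G.aux₂ s r r').IsStronglyConnected :=
  aux_isStronglyConnected (aux_isStronglyConnected hG).reverse

theorem root_mem_aux₂ (hG : G.IsStronglyConnected) (hs : s ∈ G.verts) (hr : G.IsRoot s r) :
    r ∈ (G.aux₂ s r r).verts :=
  root_mem_aux (aux_isStronglyConnected hG).reverse (root_mem_aux hG hs hr) (.inl rfl)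

theorem aux₂_self_goodIn (hG : G.IsStronglyConnected) (hs : s ∈ G.verts) (hr : G.IsRoot s r)
    (hv : v ∈ (G.aux₂ s r r).verts) : (G.aux₂ s r r).GoodIn r (G.ordinary₂ s r r) v :=
  aux_goodIn (aux_isStronglyConnected hG).reverse (root_mem_aux hG hs hr) (.inl rfl)
    (fun _ h => h.2) hv fun h => absurd rfl h

theorem aux₂_self_goodOut (hG : G.IsStronglyConnected) (hs : s ∈ G.verts) (hr : G.IsRoot s r)
    (hv : v ∈ (G.aux₂ s r r).verts) (hd : r ≠ s → v ≠ G.idom s r) :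
    (G.aux₂ s r r).GoodOut r (G.ordinary₂ s r r) v := by
  have hL := (aux_isStronglyConnected (s := s) (r := r) hG).reverse
  have hrL : r ∈ (G.aux s r).reverse.verts := root_mem_aux hG hs hr
  have h := aux_goodOut (L := (G.aux s r).reverse) (s := r) (r := r) (t := r) (S := G.tree s r)
    (O := G.ordinary₂ s r r) (fun u hu => reverse_aux_robustTo hG hs hr hu)
    (fun _ h => ⟨h.2, h.1⟩) hv fun u hu huv => ?_
  · rwa [shrink_of_mem_tree (mem_tree_self hL hrL hrL)] at h
  -- `d(r)` is shrunk to itself, so a vertex other than `d(r)` does not have it as a preimage.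
  · refine reverse_aux_cases hG hs hr hu fun hne hud => hd hne ?_
    have hsh := (isShrunk_idom hG hs hr hne).1
    rw [← huv, hud]
    exact hsh.shrink_eq hL hrL (mem_domSubtree_self (hsh.mem_verts hL hrL))

theorem aux₂_adj_idom_iff (hG : G.IsStronglyConnected) (hs : s ∈ G.verts) (hr : G.IsRoot s r)
    (hne : r ≠ s) : (G.aux₂ s r r).Adj u (G.idom s r) ↔ u = r := by
  have hL := (aux_isStronglyConnected (s := s) (r := r) hG).reverse
  have hrL : r ∈ (G.aux s r).reverse.verts := root_mem_aux hG hs hr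
  obtain ⟨h1, h2⟩ := isShrunk_idom hG hs hr hne
  have := h1.adj_iff (u := u) (.inl rfl) hL hrL
  rwa [h2] at this

theorem aux₂_deleteEdge_not_adj_idom (hG : G.IsStronglyConnected) (hs : s ∈ G.verts)
    (hr : G.IsRoot s r) (hne : r ≠ s) :
    ¬ ((G.aux₂ s r r).deleteEdge r (G.idom s r)).Adj u (G.idom s r) := by
  have hL := (aux_isStronglyConnected (s := s) (r := r) hG).reverse
  have hrL : r ∈ (G.aux s r).reverse.verts := root_mem_aux hG hs hr
  obtain ⟨h1, h2⟩ := isShrunk_idom hG hs hr hne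
  have h3 := h1.mult_le_one (.inl rfl) hL hrL
  rw [h2] at h3
  intro h
  rw [deleteEdge_adj] at h
  have hu := (aux₂_adj_idom_iff hG hs hr hne).1 h.1
  have h4 := h.2 hu rfl
  rw [hu] at h4
  exact absurd (h4.trans h3) (by decide)

theorem aux₂_splitsOff_or (hG : G.IsStronglyConnected) (hs : s ∈ G.verts) (hr : G.IsRoot s r)
    (hne : r ≠ s) (he : (G.aux₂ s r r).IsStrongBridge x y) :
    (G.aux₂ s r r).SplitsOff (G.ordinary₂ s r r) x y ∨
      (G.SoleExit s r x ∧
        (G.aux₂ s r r).SplitsOffWith (G.ordinary₂ s r r) (G.idom s r) x y) := by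
  have hL := (aux_isStronglyConnected (s := s) (r := r) hG).reverse
  have hrL : r ∈ (G.aux s r).reverse.verts := root_mem_aux hG hs hr
  obtain ⟨h1, -⟩ := isShrunk_idom hG hs hr hne
  have hdT := h1.not_mem_tree hL hrL (mem_domSubtree_self (h1.mem_verts hL hrL))
  have hda := (aux₂_adj_idom_iff hG hs hr hne).2 rfl
  refine (splitsOff_or_splitsOffWith (aux₂_isStronglyConnected hG) (root_mem_aux₂ hG hs hr)
    hda.right_mem (h1.ne hL hrL) (fun h => hdT h.2) (fun _ => aux_not_adj_self)
    (fun u => (aux₂_adj_idom_iff hG hs hr hne).1) he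
    (fun v hv => aux₂_self_goodIn hG hs hr hv)
    (fun v hv hvd => aux₂_self_goodOut hG hs hr hv fun _ => hvd)).imp_right ?_
  rintro ⟨hx, hxO, hsole, hw⟩
  -- If `x` were shrunken, its in-neighbour `d(r)` would have to lie in the tree, but `d(r)` is
  -- itself shrunken.
  have hxT : x ∈ (G.aux s r).reverse.tree r r := by
    rcases aux_verts_cases hL hrL hx with h | h | h
    · exact h
    · have := (h.adj_iff (.inl rfl) hL hrL).1 ((hsole x).2 rfl)
      exact absurd (this ▸ h.2) hdT
    · exact absurd rfl h.1
  exact ⟨⟨fun h => hxO ⟨h, hxT⟩, hxT, hsole⟩, hw⟩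

/-- The strong bridges of the simplified graph. -/
theorem auxTilde_splitsOff (hG : G.IsStronglyConnected) (hs : s ∈ G.verts) (hr : G.IsRoot s r)
    (hne : r ≠ s) (he : (G.auxTilde s r).IsStrongBridge x y) :
    (G.auxTilde s r).SplitsOff (G.ordinary₂ s r r) x y := by
  have hL := (aux_isStronglyConnected (s := s) (r := r) hG).reverse
  have hrL : r ∈ (G.aux s r).reverse.verts := root_mem_aux hG hs hr
  by_cases h : ∃ w, G.SoleExit s r w
  · have hsole := h.choose_spec.2.2
    rw [auxTilde, dif_pos h] at he ⊢
    exact splitsOff_bypass (root_mem_aux₂ hG hs hr)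
      ((isShrunk_idom hG hs hr hne).1.ne hL hrL) (fun _ => aux_not_adj_self)
      (fun u => aux₂_deleteEdge_not_adj_idom hG hs hr hne) hsole
      (fun v hv => aux₂_self_goodIn hG hs hr hv)
      (fun v hv hvd => aux₂_self_goodOut hG hs hr hv fun _ => hvd) he
  · rw [auxTilde, dif_neg h] at he ⊢
    exact (aux₂_splitsOff_or hG hs hr hne he).resolve_right fun h' => h ⟨x, h'.1⟩

/-! ### The graphs in `S(H_{rr'}, (d(r'), r'))` -/

/-- The start vertex `r` of `H_r^R` lies outside `D(r')`, so it is shrunk into `d(r')`. Hence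
vertices are reached from `r'` but reach `d(r')`. -/
theorem sAux_splitsOff_or_four (hG : G.IsStronglyConnected) (hs : s ∈ G.verts)
    (hr : G.IsRoot s r) (hr' : (G.aux s r).reverse.Marked r r') (hC : G.IsCritComp s r r' C)
    (he : (G.sAux s r r' C).IsStrongBridge x y) :
    (G.sAux s r r' C).SplitsOff (C ∩ G.ordinary₂ s r r') x y ∨
      (G.sAux s r r' C).FourSingletons (C ∩ G.ordinary₂ s r r') C (G.crit₂ s r r') r' x y := by
  have hL := (aux_isStronglyConnected (s := s) (r := r) hG).reverse
  have hrL : r ∈ (G.aux s r).reverse.verts := root_mem_aux hG hs hr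
  have hroot : (G.aux s r).reverse.IsRoot r r' := .inr hr'
  have hb := hr'.isBridge hL hrL
  have hne : r' ≠ r := hb.start_ne.symm
  have hadj := fun v => aux_idom_adj_iff (v := v) hroot hL hrL hne
  have hsr : (G.aux s r).reverse.shrink r r' r = G.crit₂ s r r' :=
    shrink_of_not_mem (start_not_mem_domSubtree hrL hne.symm)
  have hr'T := mem_tree_self hL hrL hb.1.right_mem
  have hout : ∀ v ∈ (G.aux₂ s r r').verts,
      (r ≠ s → (G.aux s r).reverse.shrink r r' (G.idom s r) ≠ v) →
      (G.aux₂ s r r').GoodOut (G.crit₂ s r r') (G.ordinary₂ s r r') v := by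
    intro v hv hd
    rw [← hsr]
    refine aux_goodOut (S := G.tree s r) (fun u hu => reverse_aux_robustTo hG hs hr hu)
      (fun _ h => ⟨h.2, h.1⟩) hv fun u hu huv => ?_
    refine reverse_aux_cases hG hs hr hu fun hrs hud => hd hrs ?_
    rw [← hud]; exact huv
  -- The exceptional vertex `d(r)` causes harm only if it is `r'` itself: otherwise, if it were in
  -- `D(r')`, so would be its immediate dominator `r` in `H_r^R`.
  have himg : ∀ hrs : r ≠ s, r' = G.idom s r ∨
      (G.aux s r).reverse.shrink r r' (G.idom s r) = G.crit₂ s r r' := by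
    intro hrs
    by_cases hd : r' = G.idom s r
    · exact .inl hd
    right
    refine shrink_of_not_mem fun hmem => ?_
    obtain ⟨h1, h2⟩ := isShrunk_idom hG hs hr hrs
    have := h1.1.mem_domSubtree_idom hL hrL hmem hd
    rw [h2] at this
    exact start_not_mem_domSubtree hrL hne.symm this
  refine splitsOff_or_four_sGraph (aux₂_isStronglyConnected hG) ((hadj r').2 rfl)
    (hb.isIdom hL hrL).1 (fun v hv => ?_)
    (fun v hv hvd => aux_goodIn hL hrL hroot (fun _ h => h.2) hv fun _ => hvd)
    (fun v hv hvd hvr => hout v hv fun hrs h => ?_) ?_ hC he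
  · have h1 := deleteEdge_adj.1 hv
    have hvr := (hadj v).1 h1.1
    have h2 := h1.2 rfl hvr
    rw [hvr] at h2
    exact absurd (h2.trans (aux_idom_mult_le_one hroot hL hrL hne)) (by decide)
  · rcases himg hrs with hd | hd
    · rw [← hd, shrink_of_mem_tree hr'T] at h
      exact hvr h.symm
    · exact hvd (h.symm.trans hd)
  -- If `r' = d(r)`, it is entered in `H_r^R` only from `r`, whose image is `d(r')`; this replaces
  -- the missing `GoodOut` property of `r'`.
  · by_cases hd : r ≠ s ∧ r' = G.idom s r
    · right
      intro u hu
      obtain ⟨a, b, hab, rfl, hbr⟩ := exists_adj_of_aux_adj hu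
      have hb' : b = r' := by
        rw [← hbr, eq_of_shrink_mem_tree hroot hL hrL hab.right_mem (by rw [hbr]; exact hr'T)]
      rw [hb', hd.2, reverse_adj, aux_idom_adj_iff hr hG hs hd.1] at hab
      rw [hab, hsr]
    · left
      refine hout r' (root_mem_aux hL hrL hroot) fun hrs h => ?_
      rcases himg hrs with h' | h'
      · exact hd ⟨hrs, h'⟩
      · exact (hb.isIdom hL hrL).1 (h'.symm.trans h)

end MultiDigraph

theorem mainTheorem8 {V : Type*} [Fintype V] (G : MultiDigraph V) (s : V) (hs : s ∈ G.verts)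
    (hG : G.IsStronglyConnected) :
    -- `H_{ss}`
    (∀ x y, (G.aux₂ s s s).IsStrongBridge x y →
      (G.aux₂ s s s).SplitsOff (G.ordinary₂ s s s) x y) ∧
    -- `H_{rr}`, simplified
    (∀ r, G.Marked s r → ∀ x y, (G.auxTilde s r).IsStrongBridge x y →
      (G.auxTilde s r).SplitsOff (G.ordinary₂ s r r) x y) ∧
    -- `H_{rr}`, unsimplified
    (∀ r, G.Marked s r → ∀ x y, (G.aux₂ s r r).IsStrongBridge x y →
      (G.aux₂ s r r).SplitsOff (G.ordinary₂ s r r) x y ∨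
      (G.SoleExit s r x ∧
        (G.aux₂ s r r).SplitsOffWith (G.ordinary₂ s r r) (G.idom s r) x y)) ∧
    -- the graphs in `S(H_{sr'}, (d(r'), r'))`
    (∀ r', (G.aux s s).reverse.Marked s r' → ∀ C, G.IsCritComp s s r' C →
      ∀ x y, (G.sAux s s r' C).IsStrongBridge x y →
        (G.sAux s s r' C).SplitsOff (C ∩ G.ordinary₂ s s r') x y ∨
        (G.sAux s s r' C).FourSingletons (C ∩ G.ordinary₂ s s r') C (G.crit₂ s s r') r' x y) ∧
    -- the graphs in `S(H_{rr'}, (d(r'), r'))`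
    (∀ r, G.Marked s r → ∀ r', (G.aux s r).reverse.Marked r r' → ∀ C, G.IsCritComp s r r' C →
      ∀ x y, (G.sAux s r r' C).IsStrongBridge x y →
        (G.sAux s r r' C).SplitsOff (C ∩ G.ordinary₂ s r r') x y ∨
        (G.sAux s r r' C).FourSingletons (C ∩ G.ordinary₂ s r r') C (G.crit₂ s r r') r' x y) := by
  have hne : ∀ r, G.Marked s r → r ≠ s := fun r ⟨_, hr⟩ => hr.start_ne.symm
  refine ⟨fun x y he => ?_, fun r hr x y he => ?_, fun r hr x y he => ?_,
    fun r' hr' C hC x y he => ?_, fun r hr r' hr' C hC x y he => ?_⟩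
  -- For `r = s` nothing is shrunk into `d(r)`, so no vertex is exceptional.
  · exact MultiDigraph.splitsOff_of_good (MultiDigraph.root_mem_aux₂ hG hs (.inl rfl)) he
      (fun v hv => MultiDigraph.aux₂_self_goodIn hG hs (.inl rfl) hv)
      fun v hv => MultiDigraph.aux₂_self_goodOut hG hs (.inl rfl) hv fun h => absurd rfl h
  · exact MultiDigraph.auxTilde_splitsOff hG hs (.inr hr) (hne r hr) he
  · exact MultiDigraph.aux₂_splitsOff_or hG hs (.inr hr) (hne r hr) he
  · exact MultiDigraph.sAux_splitsOff_or_four hG hs (.inl rfl) hr' hC he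
  · exact MultiDigraph.sAux_splitsOff_or_four hG hs (.inr hr) hr' hC he
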